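/- Let $\mathcal Y$ be a measurable space and $P>0$. A channel with memory, with real inputs and outputs in $\mathcal Y$, is given by its transition probability laws $W_n(\mathrm d y\mid x)$, $x\in\mathbb R^n$, $y\in\mathcal Y^n$, $n\ge 0$. Assume that there is a stationary and ergodic process $(\mathsf x_k,\mathsf y_k)_{k\ge 0}$ such that for every $n$ its initial segment of length $n$ has the law of an input block distributed as $\mathcal N(0,P I_n)$ together with the corresponding output block of $W_n$. For a super symbol length $S$ let $\underline{\mathsf x}\sim\mathcal N(0,PI_S)$ and let $\underline{\mathsf y}$ be the corresponding output super symbol, let $g_S(\underline y)=\mathbf E[\underline{\mathsf x}\mid\underline{\mathsf y}=\underline y]$ be (any measurable version of) the MMSE smoother, let $a_S=\mathbf E[\underline{\mathsf x}^{T}g_S(\underline{\mathsf y})]/(SP)$, and let $$\mathsf{mmse}_S=\frac1S\,\mathbf E\big[\|\underline{\mathsf x}-\mathbf E[\underline{\mathsf x}\mid\underline{\mathsf y}]\|^2\big].$$ For a code rate $R$ (nats per channel use), codeword length $N$ (in super symbols) and super symbol length $S$, the encoder uses a codebook of $M=\lceil e^{NSR}\rceil$ independent $\mathcal N(0,PI_{NS})$-distributed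 codewords $\underline x(m)=[\underline x_1(m),\dots,\underline x_N(m)]$, and upon receiving $\underline y=[\underline y_1,\dots,\underline y_N]$ the decoder decides for the message that minimizes $D(m)=\sum_{n=1}^N\|g_S(\underline y_n)-a_S\,\underline x_n(m)\|^2$, ties being counted as errors. Let $P_e(S,N,R)$ be the probability of decoding error, averaged over equiprobable messages and over the codebook ensemble. Assume that $\mathsf{mmse}=\lim_{S\to\infty}\mathsf{mmse}_S$ exists. Then the information rate $$I_{\mathrm{GMI},\mathrm{MMSE}}=\frac12\log\frac{P}{\mathsf{mmse}}$$ ($+\infty$ if $\mathsf{mmse}=0$) is achievable, in the following sense. For every $R<I_{\mathrm{GMI},\mathrm{MMSE}}$: 1. for every $\varepsilon>0$ there is $S_0$ such that for every $S\ge S_0$ one has $P_e(S,N,R)\le\varepsilon$ for all sufficiently large $N$; 2. there is $S_1$ such that for every fixed $S\ge S_1$ for which the process of length-$S$ super symbols is itself ergodic (that is, the $S$-th power of the shift is ergodic), $P_e(S,N,R)\to0$ as $N\to\infty$. -/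

import Mathlib

open MeasureTheory ProbabilityTheory Filter Topology
open scoped NNReal ENNReal

noncomputable section

namespace MemoryChannel

variable {𝒴 : Type*} [MeasurableSpace 𝒴]

/-- The law `𝒩(0, P Iₙ)` of an i.i.d. Gaussian input block of length `n`. -/
def gaussianBlock (P : ℝ≥0) (n : ℕ) : Measure (Fin n → ℝ) :=
  Measure.pi fun _ => gaussianReal 0 P

/-- A channel with memory is given by its transition laws `W n` for all block lengths `n`. This is
the joint law of an i.i.d. Gaussian input block of length `n` and the corresponding output block. -/
def jointLaw (P : ℝ≥0) (W : ∀ n, Kernel (Fin n → ℝ) (Fin n → 𝒴)) (n : ℕ) :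
    Measure ((Fin n → ℝ) × (Fin n → 𝒴)) :=
  (gaussianBlock P n) ⊗ₘ (W n)

/-- The left shift on sequences. -/
def shift {α : Type*} (ω : ℕ → α) : ℕ → α := fun k => ω (k + 1)

/-- The initial segment of length `n` of an input/output sequence, split into inputs and outputs. -/
def segment (n : ℕ) (ω : ℕ → ℝ × 𝒴) : (Fin n → ℝ) × (Fin n → 𝒴) :=
  (fun i => (ω i).1, fun i => (ω i).2)

/-- Under i.i.d. Gaussian inputs, the channel inputs and outputs of a block of any length `n` are
a segment drawn from the stationary and ergodic input/output process with law `μ`. -/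
structure IsStationaryErgodic (P : ℝ≥0) (W : ∀ n, Kernel (Fin n → ℝ) (Fin n → 𝒴))
    (μ : Measure (ℕ → ℝ × 𝒴)) : Prop where
  isProbabilityMeasure : IsProbabilityMeasure μ
  ergodic : Ergodic shift μ
  map_segment : ∀ n, μ.map (segment n) = jointLaw P W n

/-- The `σ`-algebra generated by the output super symbol. -/
abbrev outputSigma (𝒴 : Type*) [MeasurableSpace 𝒴] (S : ℕ) :
    MeasurableSpace ((Fin S → ℝ) × (Fin S → 𝒴)) :=
  MeasurableSpace.comap Prod.snd inferInstance

/-- `E[x | y]`, coordinate by coordinate, for a super symbol of length `S`. -/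
def condMean (P : ℝ≥0) (W : ∀ n, Kernel (Fin n → ℝ) (Fin n → 𝒴)) (S : ℕ) (i : Fin S) :
    (Fin S → ℝ) × (Fin S → 𝒴) → ℝ :=
  (jointLaw P W S)[fun p => p.1 i | outputSigma 𝒴 S]

/-- The normalized MMSE `(1/S) E ‖x - E[x | y]‖²`. -/
def normalizedMMSE (P : ℝ≥0) (W : ∀ n, Kernel (Fin n → ℝ) (Fin n → 𝒴)) (S : ℕ) : ℝ :=
  (1 / (S : ℝ)) * ∫ p, ∑ i : Fin S, (p.1 i - condMean P W S i p) ^ 2 ∂(jointLaw P W S)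

/-- `g` is (a version of) the MMSE smoother `g(y) = E[x | y]`. -/
structure IsMMSESmoother (P : ℝ≥0) (W : ∀ n, Kernel (Fin n → ℝ) (Fin n → 𝒴)) (S : ℕ)
    (g : (Fin S → 𝒴) → (Fin S → ℝ)) : Prop where
  measurable : Measurable g
  ae_eq : ∀ i, (fun p => g p.2 i) =ᵐ[jointLaw P W S] condMean P W S i

/-- An MMSE smoother exists. -/
lemma exists_isMMSESmoother (P : ℝ≥0) (W : ∀ n, Kernel (Fin n → ℝ) (Fin n → 𝒴)) (S : ℕ) :
    ∃ g, IsMMSESmoother P W S g := by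
  have h : ∀ i : Fin S, ∃ f : (Fin S → 𝒴) → ℝ, Measurable f ∧
      condMean P W S i = f ∘ Prod.snd := fun i =>
    (stronglyMeasurable_condExp.measurable
      (f := (jointLaw P W S)[fun p => p.1 i | outputSigma 𝒴 S])).exists_eq_measurable_comp
  choose f hf hfe using h
  refine ⟨fun y i => f i y, measurable_pi_lambda _ hf, fun i => ?_⟩
  rw [hfe i]
  exact Filter.EventuallyEq.rfl

/-- The scaling parameter `a = E[xᵀ g(y)] / (S P)`. -/
def scaling (P : ℝ≥0) (W : ∀ n, Kernel (Fin n → ℝ) (Fin n → 𝒴)) (S : ℕ)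
    (g : (Fin S → 𝒴) → (Fin S → ℝ)) : ℝ :=
  (∫ p, ∑ i : Fin S, p.1 i * g p.2 i ∂(jointLaw P W S)) / (S * P)

/-- The `n`-th length-`S` super symbol of a block of length `N * S`. -/
def superSymbol {α : Type*} {N S : ℕ} (z : Fin (N * S) → α) (n : Fin N) : Fin S → α :=
  fun s => z (finProdFinEquiv (n, s))

/-- The nearest neighbour decoding metric `∑ₙ ‖g(yₙ) - a xₙ‖²` of a codeword `x`. -/
def metric {N S : ℕ} (g : (Fin S → 𝒴) → (Fin S → ℝ)) (a : ℝ)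
    (y : Fin (N * S) → 𝒴) (x : Fin (N * S) → ℝ) : ℝ :=
  ∑ n : Fin N, ∑ s : Fin S, (g (superSymbol y n) s - a * superSymbol x n s) ^ 2

/-- The number `M = ⌈e^{NSR}⌉` of messages for `N` super symbols of length `S` at rate `R` (nats
per channel use). -/
def numMessages (N S : ℕ) (R : ℝ) : ℕ := ⌈Real.exp (N * S * R)⌉₊

/-- The codebook `c` and the output block `y` lead to a decoding error for the message `m`: the
codeword of `m` is not the unique minimizer of the metric. (Ties count as errors.) -/
def IsError {N S M : ℕ} (g : (Fin S → 𝒴) → (Fin S → ℝ)) (a : ℝ)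
    (c : Fin M → Fin (N * S) → ℝ) (m : Fin M) (y : Fin (N * S) → 𝒴) : Prop :=
  ∃ m' : Fin M, m' ≠ m ∧ metric g a y (c m') ≤ metric g a y (c m)

/-- The probability of decoding error, averaged over equiprobable messages and over the ensemble of
codebooks of `M = ⌈e^{NSR}⌉` independent `𝒩(0, P I_{NS})` codewords. -/
def averageError (P : ℝ≥0) (W : ∀ n, Kernel (Fin n → ℝ) (Fin n → 𝒴)) (S : ℕ)
    (g : (Fin S → 𝒴) → (Fin S → ℝ)) (a R : ℝ) (N : ℕ) : ℝ≥0∞ :=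
  ((numMessages N S R : ℕ) : ℝ≥0∞)⁻¹ * ∑ m : Fin (numMessages N S R),
    ∫⁻ c, W (N * S) (c m) {y | IsError g a c m y}
      ∂(Measure.pi fun _ : Fin (numMessages N S R) => gaussianBlock P (N * S))

/-- The rate `I` (possibly `+∞`) is achievable with processing functions `g S` and scaling
parameters `a S`: at every code rate `R < I`, the average probability of decoding error is
eventually below every `ε > 0`, for all large super symbol lengths `S` and all codeword lengths `N`
that are large enough for this `S`. -/
def IsAchievable (P : ℝ≥0) (W : ∀ n, Kernel (Fin n → ℝ) (Fin n → 𝒴))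
    (g : ∀ S, (Fin S → 𝒴) → (Fin S → ℝ)) (a : ℕ → ℝ) (I : EReal) : Prop :=
  ∀ R : ℝ, (R : EReal) < I → ∀ ε : ℝ≥0∞, 0 < ε →
    ∀ᶠ S : ℕ in atTop, ∀ᶠ N : ℕ in atTop, averageError P W S (g S) (a S) R N ≤ ε

/-- The rate `I` is achievable with a fixed super symbol length, which may be any large `S` with
`Q S`: at every code rate `R < I`, the average probability of decoding error with such an `S` tends
to `0` as the codeword length `N` tends to infinity. -/
def IsAchievableFixedLength (P : ℝ≥0) (W : ∀ n, Kernel (Fin n → ℝ) (Fin n → 𝒴))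
    (g : ∀ S, (Fin S → 𝒴) → (Fin S → ℝ)) (a : ℕ → ℝ) (Q : ℕ → Prop) (I : EReal) : Prop :=
  ∀ R : ℝ, (R : EReal) < I → ∀ᶠ S : ℕ in atTop, Q S →
    Tendsto (averageError P W S (g S) (a S) R) atTop (𝓝 0)

/-- The rate `½ log (P / mmse)` in nats, equal to `+∞` if `mmse = 0`. -/
def gmiRate (P : ℝ≥0) (mmse : ℝ) : EReal :=
  (((1 : ℝ) / 2 : ℝ) : EReal) * ENNReal.log ((P : ℝ≥0∞) / ENNReal.ofReal mmse)

end MemoryChannel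

end

/-
Chernoff's bound for the Gaussian moment generating function of `(h - a x)²` bounds the probability
that an independent codeword does better than the transmitted one, with an exponent that depends
only on the metric of the transmitted codeword and on the energy of the estimates. If both are
close to their means and the Chernoff parameter `t` is chosen such that `1 + 2 t a² P = 1 / (1 - b)`
with `b ≤ a`, the exponent is close to `½ log (1 - b)` per symbol. Taking `b` slightly below
`1 - mmse / P = lim a_S` yields every rate below the GMI; the gap between `b` and the limit keeps
`t` finite when `mmse = 0`.

When the super symbols form an ergodic process, both quantities concentrate by the mean ergodic
theorem. In general the `S`-th power of the shift need not be ergodic. However, the smoother for a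
fixed window length `L` already captures almost all of the limiting power of the estimates, so in
a super symbol with `S` large most estimates differ little in `L²` from those obtained from a
window around the symbol. The total loss of a super symbol is thus close in `L¹` to a Birkhoff sum
of a fixed function along the ergodic process of symbols, and these concentrate.
-/

namespace MemoryChannel

section Integrals

variable {α E : Type*} [MeasurableSpace α] {μ : Measure α} [NormedAddCommGroup E]

lemma integral_norm_sum_le {ι : Type*} (s : Finset ι) {f : ι → α → E}
    (hf : ∀ i ∈ s, Integrable (f i) μ) :
    ∫ ω, ‖∑ i ∈ s, f i ω‖ ∂μ ≤ ∑ i ∈ s, ∫ ω, ‖f i ω‖ ∂μ := by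
  rw [← integral_finsetSum s fun i hi => (hf i hi).norm]
  exact integral_mono (integrable_finsetSum s hf).norm
    (integrable_finsetSum s fun i hi => (hf i hi).norm) fun ω => norm_sum_le s fun i => f i ω

lemma integral_norm_le_norm_toLp_two [IsProbabilityMeasure μ] {f : α → E} (hf : MemLp f 2 μ) :
    ∫ ω, ‖f ω‖ ∂μ ≤ ‖hf.toLp f‖ := by
  rw [Lp.norm_toLp, integral_norm_eq_lintegral_enorm hf.1, ← eLpNorm_one_eq_lintegral_enorm]
  exact ENNReal.toReal_mono hf.2.ne (eLpNorm_le_eLpNorm_of_exponent_le (by norm_num) hf.1)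

lemma measure_le_ofReal_integral_div [IsFiniteMeasure μ] {f : α → ℝ} (hf0 : 0 ≤ f)
    (hf : Integrable f μ) {ε : ℝ} (hε : 0 < ε) :
    μ {ω | ε ≤ f ω} ≤ ENNReal.ofReal ((∫ ω, f ω ∂μ) / ε) := by
  rw [← ofReal_measureReal]
  refine ENNReal.ofReal_le_ofReal ((le_div_iff₀' hε).2 ?_)
  exact mul_meas_ge_le_integral_of_nonneg (ae_of_all _ hf0) hf ε

lemma memLp_sq {f : α → ℝ} (hf : MemLp f 4 μ) : MemLp (fun ω => f ω ^ 2) 2 μ := by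
  have : ENNReal.HolderTriple 4 4 2 := ⟨by
    rw [← two_mul, show (4 : ℝ≥0∞) = 2 * 2 by norm_num, ENNReal.mul_inv (by simp) (by simp),
      ← mul_assoc, ENNReal.mul_inv_cancel (by simp) (by simp), one_mul]⟩
  simpa only [sq] using hf.mul' (r := 2) hf

lemma integral_sub_sq {f h : α → ℝ} (hf : MemLp f 2 μ) (hh : MemLp h 2 μ) :
    ∫ ω, (f ω - h ω) ^ 2 ∂μ = ∫ ω, f ω ^ 2 ∂μ - 2 * ∫ ω, h ω * f ω ∂μ + ∫ ω, h ω ^ 2 ∂μ := by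
  have hfh : Integrable (fun ω => 2 * (h ω * f ω)) μ := (hh.integrable_mul hf).const_mul 2
  have hffh : Integrable (fun ω => f ω ^ 2 - 2 * (h ω * f ω)) μ := hf.integrable_sq.sub hfh
  have hexpand : ∀ ω, (f ω - h ω) ^ 2 = f ω ^ 2 - 2 * (h ω * f ω) + h ω ^ 2 := fun ω => by ring
  simp only [hexpand]
  rw [integral_add hffh hh.integrable_sq,
    integral_sub hf.integrable_sq hfh, integral_const_mul]

lemma abs_sq_sub_sq_le {η : ℝ} (hη : 0 < η) (x y : ℝ) :
    |x ^ 2 - y ^ 2| ≤ (x - y) ^ 2 / (2 * η) + η * (x ^ 2 + y ^ 2) := by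
  have hyoung : |x - y| * |x + y| ≤ (x - y) ^ 2 / (2 * η) + η / 2 * (x + y) ^ 2 := by
    have hsq : (x - y) ^ 2 / (2 * η) + η / 2 * (x + y) ^ 2 - |x - y| * |x + y| =
        (|x - y| - η * |x + y|) ^ 2 / (2 * η) := by
      rw [← sq_abs (x - y), ← sq_abs (x + y)]
      field_simp
      ring
    have : 0 ≤ (|x - y| - η * |x + y|) ^ 2 / (2 * η) := by positivity
    linarith
  rw [show x ^ 2 - y ^ 2 = (x - y) * (x + y) by ring, abs_mul]
  nlinarith [mul_nonneg hη.le (sq_nonneg (x - y))]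

lemma integral_abs_sq_sub_sq_le {f h : α → ℝ} (hf : MemLp f 2 μ) (hh : MemLp h 2 μ) {η : ℝ}
    (hη : 0 < η) :
    ∫ ω, |f ω ^ 2 - h ω ^ 2| ∂μ ≤
      (∫ ω, (f ω - h ω) ^ 2 ∂μ) / (2 * η) + η * (∫ ω, f ω ^ 2 ∂μ + ∫ ω, h ω ^ 2 ∂μ) := by
  have hsq : Integrable (fun ω => f ω ^ 2 + h ω ^ 2) μ := hf.integrable_sq.add hh.integrable_sq
  have hdiff : Integrable (fun ω => (f ω - h ω) ^ 2) μ := (hf.sub hh).integrable_sq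
  rw [← integral_add hf.integrable_sq hh.integrable_sq, ← integral_div, ← integral_const_mul,
    ← integral_add (hdiff.div_const _) (hsq.const_mul _)]
  exact integral_mono (hf.integrable_sq.sub hh.integrable_sq).abs
    ((hdiff.div_const _).add (hsq.const_mul _)) fun ω => abs_sq_sub_sq_le hη (f ω) (h ω)

end Integrals

section Birkhoff

variable {α E : Type*} [NormedAddCommGroup E]

lemma birkhoffSum_iterate_birkhoffSum {M : Type*} [AddCommMonoid M] (T : α → α) (h : α → M)
    (S N : ℕ) (ω : α) :
    birkhoffSum T^[S] (birkhoffSum T h S) N ω = birkhoffSum T h (N * S) ω := by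
  induction N with
  | zero => simp
  | succ N ih =>
    rw [birkhoffSum_succ, ih, Nat.succ_mul, birkhoffSum_add, ← Function.iterate_mul, mul_comm S N]

lemma birkhoffAverage_iterate_birkhoffSum {M : Type*} [AddCommGroup M] [Module ℝ M] (T : α → α)
    (h : α → M) (S N : ℕ) (ω : α) :
    birkhoffAverage ℝ T^[S] (birkhoffSum T h S) N ω = S • birkhoffAverage ℝ T h (N * S) ω := by
  rcases eq_or_ne S 0 with rfl | hS
  · simp [birkhoffAverage, birkhoffSum]
  · have hcast : (S : ℝ) * ((N * S : ℕ) : ℝ)⁻¹ = (N : ℝ)⁻¹ := by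
      rw [Nat.cast_mul, mul_inv, mul_left_comm, mul_inv_cancel₀ (Nat.cast_ne_zero.2 hS), mul_one]
    simp only [birkhoffAverage, birkhoffSum_iterate_birkhoffSum, ← Nat.cast_smul_eq_nsmul ℝ S,
      smul_smul, hcast]

variable [MeasurableSpace α] {μ : Measure α} {T : α → α}

lemma memLp_birkhoffSum (hT : MeasurePreserving T μ μ) {f : α → E} {p : ℝ≥0∞}
    (hf : MemLp f p μ) (N : ℕ) : MemLp (birkhoffSum T f N) p μ :=
  memLp_finsetSum _ fun n _ => hf.comp_measurePreserving (hT.iterate n)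

variable [NormedSpace ℝ E]

lemma memLp_birkhoffAverage (hT : MeasurePreserving T μ μ) {f : α → E} {p : ℝ≥0∞}
    (hf : MemLp f p μ) (N : ℕ) : MemLp (birkhoffAverage ℝ T f N) p μ :=
  (memLp_birkhoffSum hT hf N).const_smul (N : ℝ)⁻¹

lemma integrable_birkhoffAverage (hT : MeasurePreserving T μ μ) {f : α → E}
    (hf : Integrable f μ) (N : ℕ) : Integrable (birkhoffAverage ℝ T f N) μ :=
  memLp_one_iff_integrable.1 (memLp_birkhoffAverage hT (memLp_one_iff_integrable.2 hf) N)

lemma integral_birkhoffSum (hT : MeasurePreserving T μ μ) {f : α → E} (hf : Integrable f μ)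
    (N : ℕ) : ∫ ω, birkhoffSum T f N ω ∂μ = N • ∫ ω, f ω ∂μ := by
  have hn : ∀ n, ∫ ω, f (T^[n] ω) ∂μ = ∫ ω, f ω ∂μ := fun n =>
    (hT.iterate n).hasLaw.integral_comp hf.1
  have hi : ∀ n, Integrable (fun ω => f (T^[n] ω)) μ := fun n =>
    (hT.iterate n).integrable_comp_of_integrable hf
  simp only [birkhoffSum]
  rw [integral_finsetSum _ fun n _ => hi n]
  simp only [hn, Finset.sum_const, Finset.card_range]

lemma integral_birkhoffAverage (hT : MeasurePreserving T μ μ) {f : α → E} (hf : Integrable f μ)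
    {N : ℕ} (hN : N ≠ 0) : ∫ ω, birkhoffAverage ℝ T f N ω ∂μ = ∫ ω, f ω ∂μ := by
  simp only [birkhoffAverage]
  rw [integral_smul, integral_birkhoffSum hT hf, ← Nat.cast_smul_eq_nsmul ℝ, smul_smul,
    inv_mul_cancel₀ (Nat.cast_ne_zero.2 hN), one_smul]

lemma integral_norm_birkhoffAverage_le (hT : MeasurePreserving T μ μ) {f : α → E}
    (hf : Integrable f μ) (N : ℕ) :
    ∫ ω, ‖birkhoffAverage ℝ T f N ω‖ ∂μ ≤ ∫ ω, ‖f ω‖ ∂μ := by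
  have hn : ∀ n, ∫ ω, ‖f (T^[n] ω)‖ ∂μ = ∫ ω, ‖f ω‖ ∂μ := fun n =>
    (hT.iterate n).hasLaw.integral_comp hf.1.norm
  calc ∫ ω, ‖birkhoffAverage ℝ T f N ω‖ ∂μ
      = (N : ℝ)⁻¹ * ∫ ω, ‖birkhoffSum T f N ω‖ ∂μ := by
        simp only [birkhoffAverage, norm_smul, norm_inv, RCLike.norm_natCast]
        exact integral_const_mul _ _
    _ ≤ (N : ℝ)⁻¹ * (N * ∫ ω, ‖f ω‖ ∂μ) := by
        gcongr
        refine (integral_norm_sum_le (Finset.range N) fun n _ =>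
          (hT.iterate n).integrable_comp_of_integrable hf).trans_eq ?_
        simp only [Function.comp_apply, hn, Finset.sum_const, Finset.card_range, nsmul_eq_mul]
    _ ≤ ∫ ω, ‖f ω‖ ∂μ := by
        rw [← mul_assoc]
        exact mul_le_of_le_one_left (integral_nonneg fun _ => norm_nonneg _) inv_mul_le_one

/-- The mean distance between the `N`-th Birkhoff average of `f` and the integral of `f`. -/
noncomputable def birkhoffDeviation (μ : Measure α) (T : α → α) (f : α → E) (N : ℕ) : ℝ :=
  ∫ ω, ‖birkhoffAverage ℝ T f N ω - ∫ ω', f ω' ∂μ‖ ∂μ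

lemma birkhoffDeviation_nonneg (f : α → E) (N : ℕ) : 0 ≤ birkhoffDeviation μ T f N :=
  integral_nonneg fun _ => norm_nonneg _

lemma measure_le_norm_birkhoffAverage_sub_le [IsProbabilityMeasure μ]
    (hT : MeasurePreserving T μ μ) {f : α → E} (hf : Integrable f μ) (N : ℕ) {ε : ℝ} (hε : 0 < ε) :
    μ {ω | ε ≤ ‖birkhoffAverage ℝ T f N ω - ∫ ω', f ω' ∂μ‖} ≤
      ENNReal.ofReal (birkhoffDeviation μ T f N / ε) :=
  measure_le_ofReal_integral_div (fun _ => norm_nonneg _)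
    ((integrable_birkhoffAverage hT hf N).sub (integrable_const _)).norm hε

lemma birkhoffDeviation_add_le [IsFiniteMeasure μ] (hT : MeasurePreserving T μ μ) {f h : α → E}
    (hf : Integrable f μ) (hh : Integrable h μ) (N : ℕ) :
    birkhoffDeviation μ T (f + h) N ≤ birkhoffDeviation μ T f N + birkhoffDeviation μ T h N := by
  have hi : ∀ {φ : α → E}, Integrable φ μ →
      Integrable (fun ω => birkhoffAverage ℝ T φ N ω - ∫ ω', φ ω' ∂μ) μ := fun hφ =>
    (integrable_birkhoffAverage hT hφ N).sub (integrable_const _)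
  simp only [birkhoffDeviation]
  rw [← integral_add (hi hf).norm (hi hh).norm]
  refine integral_mono (hi (hf.add hh)).norm ((hi hf).norm.add (hi hh).norm) fun ω => ?_
  simp only [Pi.add_apply, birkhoffAverage_add, integral_add hf hh, add_sub_add_comm]
  exact norm_add_le _ _

lemma birkhoffDeviation_le_two_mul_integral_norm [IsProbabilityMeasure μ]
    (hT : MeasurePreserving T μ μ) {f : α → E} (hf : Integrable f μ) (N : ℕ) :
    birkhoffDeviation μ T f N ≤ 2 * ∫ ω, ‖f ω‖ ∂μ := by
  have havg := integrable_birkhoffAverage hT hf N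
  calc birkhoffDeviation μ T f N
      ≤ ∫ ω, (‖birkhoffAverage ℝ T f N ω‖ + ‖∫ ω', f ω' ∂μ‖) ∂μ :=
        integral_mono (havg.sub (integrable_const _)).norm (havg.norm.add (integrable_const _))
          fun ω => norm_sub_le _ _
    _ = ∫ ω, ‖birkhoffAverage ℝ T f N ω‖ ∂μ + ‖∫ ω, f ω ∂μ‖ := by
        rw [integral_add havg.norm (integrable_const _), integral_const, probReal_univ, one_smul]
    _ ≤ 2 * ∫ ω, ‖f ω‖ ∂μ := by
        linarith [integral_norm_birkhoffAverage_le hT hf N,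
          norm_integral_le_integral_norm (μ := μ) f]

lemma birkhoffDeviation_iterate_birkhoffSum (hT : MeasurePreserving T μ μ) {h : α → E}
    (hh : Integrable h μ) (S N : ℕ) :
    birkhoffDeviation μ T^[S] (birkhoffSum T h S) N = S * birkhoffDeviation μ T h (N * S) := by
  simp only [birkhoffDeviation]
  rw [← integral_const_mul]
  refine integral_congr_ae (ae_of_all _ fun ω => ?_)
  simp only [birkhoffAverage_iterate_birkhoffSum, integral_birkhoffSum hT hh, ← smul_sub,
    ← Nat.cast_smul_eq_nsmul ℝ S, norm_smul, RCLike.norm_natCast]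

lemma birkhoffDeviation_iterate_le [IsProbabilityMeasure μ] (hT : MeasurePreserving T μ μ)
    {f h : α → E} (hf : Integrable f μ) (hh : Integrable h μ) (S N : ℕ) :
    birkhoffDeviation μ T^[S] f N ≤
      2 * ∫ ω, ‖f ω - birkhoffSum T h S ω‖ ∂μ + S * birkhoffDeviation μ T h (N * S) := by
  have hsum := memLp_one_iff_integrable.1
    (memLp_birkhoffSum hT (memLp_one_iff_integrable.2 hh) S)
  calc birkhoffDeviation μ T^[S] f N
      = birkhoffDeviation μ T^[S] ((f - birkhoffSum T h S) + birkhoffSum T h S) N := by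
        rw [sub_add_cancel]
    _ ≤ birkhoffDeviation μ T^[S] (f - birkhoffSum T h S) N +
          birkhoffDeviation μ T^[S] (birkhoffSum T h S) N :=
        birkhoffDeviation_add_le (hT.iterate S) (hf.sub hsum) hsum N
    _ ≤ 2 * ∫ ω, ‖f ω - birkhoffSum T h S ω‖ ∂μ + S * birkhoffDeviation μ T h (N * S) :=
        add_le_add (birkhoffDeviation_le_two_mul_integral_norm (hT.iterate S) (hf.sub hsum) N)
          (birkhoffDeviation_iterate_birkhoffSum hT hh S N).le

end Birkhoff

section MeanErgodic

variable {α E : Type*} [MeasurableSpace α] {μ : Measure α} {T : α → α} [NormedAddCommGroup E]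

lemma toLp_birkhoffSum (hT : MeasurePreserving T μ μ) {f : α → E} {p : ℝ≥0∞} (hf : MemLp f p μ)
    (N : ℕ) : (memLp_birkhoffSum hT hf N).toLp _ =
      birkhoffSum (Lp.compMeasurePreserving T hT) _root_.id N (hf.toLp f) := by
  induction N with
  | zero => exact MemLp.toLp_zero _
  | succ N ih =>
    rw [birkhoffSum_succ, ← ih, Lp.compMeasurePreserving_iterate, _root_.id,
      Lp.toLp_compMeasurePreserving, ← MemLp.toLp_add]
    exact MemLp.toLp_congr _ _ (ae_of_all _ fun ω => birkhoffSum_succ T f N ω)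

lemma toLp_birkhoffAverage [NormedSpace ℝ E] (hT : MeasurePreserving T μ μ) {f : α → E}
    {p : ℝ≥0∞} (hf : MemLp f p μ) (N : ℕ) : (memLp_birkhoffAverage hT hf N).toLp _ =
      birkhoffAverage ℝ (Lp.compMeasurePreserving T hT) _root_.id N (hf.toLp f) := by
  rw [birkhoffAverage, ← toLp_birkhoffSum, ← MemLp.toLp_const_smul]
  rfl

variable [IsProbabilityMeasure μ]

lemma exists_eq_toLp_const_of_compMeasurePreserving_eq (hT : Ergodic T μ) {p : ℝ≥0∞}
    {F : Lp E p μ} (hF : Lp.compMeasurePreserving T hT.toMeasurePreserving F = F) :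
    ∃ c : E, F = (memLp_const c).toLp fun _ => c := by
  have hinv : F ∘ T =ᵐ[μ] F := by
    simpa only [hF] using (Lp.coeFn_compMeasurePreserving F hT.toMeasurePreserving).symm
  obtain ⟨c, hc⟩ := hT.ae_eq_const_of_ae_eq_comp_ae (Lp.aestronglyMeasurable F) hinv
  exact ⟨c, Lp.ext (hc.trans (memLp_const c).coeFn_toLp.symm)⟩

variable [InnerProductSpace ℝ E] [CompleteSpace E] {f : α → E}

lemma exists_tendsto_integral_norm_birkhoffAverage_sub (hT : Ergodic T μ) (hf : MemLp f 2 μ) :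
    ∃ c : E, Tendsto (fun N => ∫ ω, ‖birkhoffAverage ℝ T f N ω - c‖ ∂μ) atTop (𝓝 0) := by
  have hmp := hT.toMeasurePreserving
  set U : Lp E 2 μ →L[ℝ] Lp E 2 μ :=
    (Lp.compMeasurePreservingₗᵢ ℝ T hmp).toContinuousLinearMap
  set F := (U.eqLocus (1 : Lp E 2 μ →L[ℝ] Lp E 2 μ)).orthogonalProjectionOnto (hf.toLp f)
  obtain ⟨c, hc⟩ := exists_eq_toLp_const_of_compMeasurePreserving_eq hT (F := F.1) F.2
  have hlim : Tendsto (birkhoffAverage ℝ U _root_.id · (hf.toLp f)) atTop (𝓝 F.1) :=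
    U.tendsto_birkhoffAverage_orthogonalProjection
      (LinearIsometry.norm_toContinuousLinearMap_le _) (hf.toLp f)
  refine ⟨c, squeeze_zero (fun N => integral_nonneg fun _ => norm_nonneg _) (fun N => ?_)
    (tendsto_iff_norm_sub_tendsto_zero.1 hlim)⟩
  calc ∫ ω, ‖birkhoffAverage ℝ T f N ω - c‖ ∂μ
      ≤ ‖((memLp_birkhoffAverage hmp hf N).sub (memLp_const c)).toLp _‖ :=
        integral_norm_le_norm_toLp_two ((memLp_birkhoffAverage hmp hf N).sub (memLp_const c))
    _ = ‖birkhoffAverage ℝ U _root_.id N (hf.toLp f) - F.1‖ := by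
        rw [MemLp.toLp_sub (memLp_birkhoffAverage hmp hf N) (memLp_const c),
          toLp_birkhoffAverage, hc]
        rfl

theorem tendsto_birkhoffDeviation (hT : Ergodic T μ) (hf : MemLp f 2 μ) :
    Tendsto (birkhoffDeviation μ T f) atTop (𝓝 0) := by
  have hmp := hT.toMeasurePreserving
  have hfi : Integrable f μ := hf.integrable (by norm_num)
  obtain ⟨c, hc⟩ := exists_tendsto_integral_norm_birkhoffAverage_sub hT hf
  have hle : ∀ᶠ N : ℕ in atTop,
      ‖∫ ω, f ω ∂μ - c‖ ≤ ∫ ω, ‖birkhoffAverage ℝ T f N ω - c‖ ∂μ := by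
    filter_upwards [eventually_ne_atTop 0] with N hN
    have hmean : ∫ ω, f ω ∂μ - c = ∫ ω, (birkhoffAverage ℝ T f N ω - c) ∂μ := by
      rw [integral_sub (integrable_birkhoffAverage hmp hfi N) (integrable_const c),
        integral_birkhoffAverage hmp hfi hN, integral_const, probReal_univ, one_smul]
    rw [hmean]
    exact norm_integral_le_integral_norm _
  have hc_eq : ∫ ω, f ω ∂μ = c := sub_eq_zero.1 (norm_le_zero_iff.1 (ge_of_tendsto hc hle))
  rw [← hc_eq] at hc
  exact hc

end MeanErgodic

section Gaussian

lemma gaussianPDFReal_mul_exp_neg_mul_sq {P : ℝ≥0} (hP : P ≠ 0) {t a : ℝ}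
    (hv : 0 < 1 + 2 * t * a ^ 2 * P) (h x : ℝ) :
    gaussianPDFReal 0 P x * Real.exp (-t * (h - a * x) ^ 2) =
      Real.exp (-(t / (1 + 2 * t * a ^ 2 * P) * h ^ 2) - Real.log (1 + 2 * t * a ^ 2 * P) / 2) *
        gaussianPDFReal (2 * t * a * h * P / (1 + 2 * t * a ^ 2 * P))
          (P / (1 + 2 * t * a ^ 2 * P)).toNNReal x := by
  have hcast : ((P / (1 + 2 * t * a ^ 2 * P)).toNNReal : ℝ) = P / (1 + 2 * t * a ^ 2 * P) :=
    Real.coe_toNNReal _ (by positivity)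
  simp only [gaussianPDFReal, hcast]
  set v := 1 + 2 * t * a ^ 2 * P with hv_def
  have hlog : Real.exp (-(t / v * h ^ 2) - Real.log v / 2) =
      Real.exp (-(t / v * h ^ 2)) * (√v)⁻¹ := by
    rw [sub_eq_add_neg, Real.exp_add, Real.exp_neg (Real.log v / 2),
      ← Real.log_sqrt hv.le, Real.exp_log (Real.sqrt_pos.2 hv)]
  have hnorm : √(2 * Real.pi * (P / v)) = √(2 * Real.pi * P) / √v := by
    rw [← mul_div_assoc, Real.sqrt_div' _ hv.le]
  have hsquare : Real.exp (-(x - 0) ^ 2 / (2 * P)) * Real.exp (-t * (h - a * x) ^ 2) =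
      Real.exp (-(t / v * h ^ 2)) *
        Real.exp (-(x - 2 * t * a * h * P / v) ^ 2 / (2 * (P / v))) := by
    rw [← Real.exp_add, ← Real.exp_add]
    congr 1
    field_simp
    rw [hv_def]
    ring
  have hsqrt : √v ≠ 0 := (Real.sqrt_pos.2 hv).ne'
  rw [hlog, hnorm, inv_div, mul_assoc, hsquare]
  field_simp

lemma mgf_sub_mul_sq_gaussianReal (P : ℝ≥0) {t a : ℝ} (hv : 0 < 1 + 2 * t * a ^ 2 * P) (h : ℝ) :
    mgf (fun x => (h - a * x) ^ 2) (gaussianReal 0 P) (-t) =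
      Real.exp (-(t / (1 + 2 * t * a ^ 2 * P) * h ^ 2) -
        Real.log (1 + 2 * t * a ^ 2 * P) / 2) := by
  rcases eq_or_ne P 0 with rfl | hP
  · simp [mgf]
  · have hvar : (P / (1 + 2 * t * a ^ 2 * P)).toNNReal ≠ 0 :=
      (Real.toNNReal_pos.2 (by positivity)).ne'
    rw [mgf, integral_gaussianReal_eq_integral_smul hP]
    simp only [smul_eq_mul, gaussianPDFReal_mul_exp_neg_mul_sq hP hv]
    rw [integral_const_mul, integral_gaussianPDFReal_eq_one _ hvar, mul_one]

instance (P : ℝ≥0) (n : ℕ) : IsProbabilityMeasure (gaussianBlock P n) := by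
  unfold gaussianBlock; infer_instance

lemma mgf_sum_sub_mul_sq_gaussianBlock (P : ℝ≥0) {t a : ℝ} (hv : 0 < 1 + 2 * t * a ^ 2 * P)
    {n : ℕ} (h : Fin n → ℝ) :
    mgf (fun x => ∑ i, (h i - a * x i) ^ 2) (gaussianBlock P n) (-t) =
      Real.exp (-(t / (1 + 2 * t * a ^ 2 * P) * ∑ i, h i ^ 2) -
        n * (Real.log (1 + 2 * t * a ^ 2 * P) / 2)) := by
  have hind : iIndepFun (fun (i : Fin n) (x : Fin n → ℝ) => (h i - a * x i) ^ 2)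
      (gaussianBlock P n) :=
    iIndepFun_pi (X := fun i x => (h i - a * x) ^ 2) fun i => by fun_prop
  have hcoord : ∀ i, mgf (fun x : Fin n → ℝ => (h i - a * x i) ^ 2) (gaussianBlock P n) (-t) =
      mgf (fun x => (h i - a * x) ^ 2) (gaussianReal 0 P) (-t) := fun i =>
    (measurePreserving_eval (fun _ : Fin n => gaussianReal 0 P) i).hasLaw.integral_comp
      (f := fun x => Real.exp (-t * (h i - a * x) ^ 2)) (by fun_prop)
  calc mgf (fun x => ∑ i, (h i - a * x i) ^ 2) (gaussianBlock P n) (-t)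
      = ∏ i, mgf (fun x : Fin n → ℝ => (h i - a * x i) ^ 2) (gaussianBlock P n) (-t) := by
        rw [← hind.mgf_sum (fun i => by fun_prop)]
        congr 1
        ext x
        rw [Finset.sum_apply]
    _ = _ := by
        simp only [hcoord, mgf_sub_mul_sq_gaussianReal P hv]
        rw [← Real.exp_sum, Finset.sum_sub_distrib, Finset.sum_neg_distrib, ← Finset.mul_sum,
          Finset.sum_const, Finset.card_univ, Fintype.card_fin, nsmul_eq_mul]

lemma gaussianBlock_sum_sub_mul_sq_le (P : ℝ≥0) {t : ℝ} (ht : 0 ≤ t) (a : ℝ) {n : ℕ}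
    (h : Fin n → ℝ) (d : ℝ) :
    gaussianBlock P n {x | ∑ i, (h i - a * x i) ^ 2 ≤ d} ≤
      ENNReal.ofReal (Real.exp (t * d - t / (1 + 2 * t * a ^ 2 * P) * ∑ i, h i ^ 2 -
        n * (Real.log (1 + 2 * t * a ^ 2 * P) / 2))) := by
  have hint : Integrable (fun x => Real.exp (-t * ∑ i, (h i - a * x i) ^ 2))
      (gaussianBlock P n) := by
    refine .of_bound (by fun_prop : Measurable _).aestronglyMeasurable 1 (ae_of_all _ fun x => ?_)
    rw [Real.norm_eq_abs, Real.abs_exp, Real.exp_le_one_iff, neg_mul]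
    exact neg_nonpos.2 (by positivity)
  rw [← ofReal_measureReal]
  refine ENNReal.ofReal_le_ofReal
    ((measure_le_le_exp_mul_mgf d (neg_nonpos.2 ht) hint).trans_eq ?_)
  rw [mgf_sum_sub_mul_sq_gaussianBlock P (by positivity), ← Real.exp_add, neg_neg]
  congr 1
  ring

end Gaussian

section RandomCoding

lemma map_eval_pair_pi {ι X : Type*} [Fintype ι] [MeasurableSpace X] (ν : Measure X)
    [IsProbabilityMeasure ν] {i j : ι} (hij : i ≠ j) :
    (Measure.pi fun _ : ι => ν).map (fun c => (c i, c j)) = ν.prod ν := by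
  have hind : iIndepFun (fun (i : ι) (c : ι → X) => c i) (Measure.pi fun _ : ι => ν) :=
    iIndepFun_pi (X := fun _ x => x) fun _ => aemeasurable_id
  rw [(indepFun_iff_map_prod_eq_prod_map_map (measurable_pi_apply i).aemeasurable
    (measurable_pi_apply j).aemeasurable).1 (hind.indepFun hij)]
  congr 1 <;> exact (measurePreserving_eval (fun _ : ι => ν) _).map_eq

variable {X Y : Type*} [MeasurableSpace X] [MeasurableSpace Y] {ν : Measure X} {κ : Kernel X Y}
  {A : Set (X × Y)} {f : X × Y → ℝ}

lemma measurableSet_mem_and_le (hA : MeasurableSet A) (hf : Measurable f) :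
    MeasurableSet {z : (X × X) × Y | (z.1.1, z.2) ∈ A ∧ f (z.1.2, z.2) ≤ f (z.1.1, z.2)} :=
  ((by fun_prop : Measurable fun z : (X × X) × Y => (z.1.1, z.2)) hA).inter
    (measurableSet_le (hf.comp (by fun_prop)) (hf.comp (by fun_prop)))

lemma measurable_kernel_mem_and_le [IsSFiniteKernel κ] (hA : MeasurableSet A)
    (hf : Measurable f) :
    Measurable fun x : X × X => κ x.1 {y | (x.1, y) ∈ A ∧ f (x.2, y) ≤ f (x.1, y)} :=
  Kernel.measurable_kernel_prodMk_left (κ := κ.comap Prod.fst measurable_fst)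
    (measurableSet_mem_and_le hA hf)

lemma lintegral_kernel_mem_and_le_le [SFinite ν] [IsMarkovKernel κ] (hA : MeasurableSet A)
    (hf : Measurable f) {q : ℝ≥0∞} (hq : ∀ p ∈ A, ν {x | f (x, p.2) ≤ f p} ≤ q) (x : X) :
    ∫⁻ x', κ x {y | (x, y) ∈ A ∧ f (x', y) ≤ f (x, y)} ∂ν ≤ q := by
  have hB : MeasurableSet {z : X × Y | (x, z.2) ∈ A ∧ f (z.1, z.2) ≤ f (x, z.2)} :=
    have hmap : Measurable fun z : X × Y => ((x, z.1), z.2) := by fun_prop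
    hmap (measurableSet_mem_and_le hA hf)
  calc ∫⁻ x', κ x {y | (x, y) ∈ A ∧ f (x', y) ≤ f (x, y)} ∂ν
      = (ν.prod (κ x)) {z | (x, z.2) ∈ A ∧ f (z.1, z.2) ≤ f (x, z.2)} :=
        (Measure.prod_apply hB).symm
    _ = ∫⁻ y, ν {x' | (x, y) ∈ A ∧ f (x', y) ≤ f (x, y)} ∂(κ x) := Measure.prod_apply_symm hB
    _ ≤ ∫⁻ _, q ∂(κ x) := by
        refine lintegral_mono fun y => ?_
        by_cases hxy : (x, y) ∈ A
        · exact (measure_mono fun x' hx' => hx'.2).trans (hq (x, y) hxy)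
        · simp [hxy]
    _ = q := by rw [lintegral_const, measure_univ, mul_one]

variable {ι : Type*} [Fintype ι]

lemma kernel_exists_ne_le_le [DecidableEq ι] (c : ι → X) (i : ι) :
    κ (c i) {y | ∃ j, j ≠ i ∧ f (c j, y) ≤ f (c i, y)} ≤
      κ (c i) (Prod.mk (c i) ⁻¹' Aᶜ) +
        ∑ j ∈ Finset.univ.erase i, κ (c i) {y | (c i, y) ∈ A ∧ f (c j, y) ≤ f (c i, y)} := by
  have hcover : {y | ∃ j, j ≠ i ∧ f (c j, y) ≤ f (c i, y)} ⊆ Prod.mk (c i) ⁻¹' Aᶜ ∪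
      ⋃ j ∈ Finset.univ.erase i, {y | (c i, y) ∈ A ∧ f (c j, y) ≤ f (c i, y)} := by
    rintro y ⟨j, hne, hle⟩
    by_cases hA : (c i, y) ∈ A
    · exact .inr (Set.mem_biUnion (Finset.mem_erase.2 ⟨hne, Finset.mem_univ j⟩) ⟨hA, hle⟩)
    · exact .inl hA
  exact (measure_mono hcover).trans
    ((measure_union_le _ _).trans (add_le_add_right (measure_biUnion_finset_le _ _) _))

variable [IsProbabilityMeasure ν] [IsMarkovKernel κ]

lemma lintegral_pairwise_error_le (hA : MeasurableSet A) (hf : Measurable f) {q : ℝ≥0∞}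
    (hq : ∀ p ∈ A, ν {x | f (x, p.2) ≤ f p} ≤ q) {i j : ι} (hij : i ≠ j) :
    ∫⁻ c, κ (c i) {y | (c i, y) ∈ A ∧ f (c j, y) ≤ f (c i, y)}
      ∂(Measure.pi fun _ : ι => ν) ≤ q := by
  have hmeas : Measurable fun x : X × X => κ x.1 {y | (x.1, y) ∈ A ∧ f (x.2, y) ≤ f (x.1, y)} :=
    measurable_kernel_mem_and_le hA hf
  have hpair : Measurable fun c : ι → X => (c i, c j) := by fun_prop
  calc ∫⁻ c, κ (c i) {y | (c i, y) ∈ A ∧ f (c j, y) ≤ f (c i, y)} ∂(Measure.pi fun _ : ι => ν)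
      = ∫⁻ x, κ x.1 {y | (x.1, y) ∈ A ∧ f (x.2, y) ≤ f (x.1, y)}
          ∂(Measure.pi fun _ : ι => ν).map (fun c => (c i, c j)) :=
        (lintegral_map hmeas hpair).symm
    _ = ∫⁻ x, ∫⁻ x', κ x {y | (x, y) ∈ A ∧ f (x', y) ≤ f (x, y)} ∂ν ∂ν := by
        rw [map_eval_pair_pi ν hij, lintegral_prod _ hmeas.aemeasurable]
    _ ≤ ∫⁻ _, q ∂ν := lintegral_mono (lintegral_kernel_mem_and_le_le hA hf hq)
    _ = q := by rw [lintegral_const, measure_univ, mul_one]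

lemma lintegral_exists_ne_le_le (hA : MeasurableSet A) (hf : Measurable f) {q : ℝ≥0∞}
    (hq : ∀ p ∈ A, ν {x | f (x, p.2) ≤ f p} ≤ q) (i : ι) :
    ∫⁻ c, κ (c i) {y | ∃ j, j ≠ i ∧ f (c j, y) ≤ f (c i, y)} ∂(Measure.pi fun _ : ι => ν) ≤
      (ν ⊗ₘ κ) Aᶜ + Fintype.card ι * q := by
  classical
  have hAc : Measurable fun x => κ x (Prod.mk x ⁻¹' Aᶜ) :=
    Kernel.measurable_kernel_prodMk_left hA.compl
  have hAci : Measurable fun c : ι → X => κ (c i) (Prod.mk (c i) ⁻¹' Aᶜ) :=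
    hAc.comp (measurable_pi_apply i)
  have hpair : ∀ j, Measurable fun c : ι → X =>
      κ (c i) {y | (c i, y) ∈ A ∧ f (c j, y) ≤ f (c i, y)} := fun j => by
    have hpair : Measurable fun c : ι → X => (c i, c j) := by fun_prop
    exact (measurable_kernel_mem_and_le (κ := κ) hA hf).comp hpair
  calc ∫⁻ c, κ (c i) {y | ∃ j, j ≠ i ∧ f (c j, y) ≤ f (c i, y)} ∂(Measure.pi fun _ : ι => ν)
      ≤ ∫⁻ c, (κ (c i) (Prod.mk (c i) ⁻¹' Aᶜ) + ∑ j ∈ Finset.univ.erase i,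
          κ (c i) {y | (c i, y) ∈ A ∧ f (c j, y) ≤ f (c i, y)}) ∂(Measure.pi fun _ : ι => ν) :=
        lintegral_mono fun c => kernel_exists_ne_le_le c i
    _ = (ν ⊗ₘ κ) Aᶜ + ∑ j ∈ Finset.univ.erase i, ∫⁻ c,
          κ (c i) {y | (c i, y) ∈ A ∧ f (c j, y) ≤ f (c i, y)} ∂(Measure.pi fun _ : ι => ν) := by
        rw [lintegral_add_left hAci, lintegral_finsetSum _ fun j _ => hpair j,
          Measure.compProd_apply hA.compl,
          ← (measurePreserving_eval (fun _ : ι => ν) i).lintegral_comp hAc]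
    _ ≤ (ν ⊗ₘ κ) Aᶜ + ∑ _j ∈ Finset.univ.erase i, q := by
        gcongr with j hj
        exact lintegral_pairwise_error_le hA hf hq (Finset.ne_of_mem_erase hj).symm
    _ ≤ (ν ⊗ₘ κ) Aᶜ + Fintype.card ι * q := by
        rw [Finset.sum_const, nsmul_eq_mul]
        gcongr
        exact Finset.card_le_univ _

end RandomCoding

section NearestNeighbourDecoding

variable {𝒴 : Type*} {N S : ℕ}

lemma metric_eq_sum (g : (Fin S → 𝒴) → Fin S → ℝ) (a : ℝ) (y : Fin (N * S) → 𝒴)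
    (x : Fin (N * S) → ℝ) :
    metric g a y x = ∑ i : Fin (N * S), (g (superSymbol y (finProdFinEquiv.symm i).1)
      (finProdFinEquiv.symm i).2 - a * x i) ^ 2 := by
  rw [← finProdFinEquiv.sum_comp, Fintype.sum_prod_type]
  simp only [metric, superSymbol, Equiv.symm_apply_apply]

/-- The exponent in the Chernoff bound with parameter `t` for the event that an independent
Gaussian codeword is at least as close to the processed outputs as the transmitted one, given the
pair `p` of the transmitted codeword and the output block. The metric at scaling `0` is the power
of the processed outputs. -/
noncomputable def pairwiseExponent (P : ℝ≥0) (g : (Fin S → 𝒴) → Fin S → ℝ) (a t : ℝ)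
    (p : (Fin (N * S) → ℝ) × (Fin (N * S) → 𝒴)) : ℝ :=
  t * metric g a p.2 p.1 - t / (1 + 2 * t * a ^ 2 * P) * metric g 0 p.2 p.1 -
    (N * S : ℕ) * (Real.log (1 + 2 * t * a ^ 2 * P) / 2)

lemma gaussianBlock_metric_le (P : ℝ≥0) {t : ℝ} (ht : 0 ≤ t) (a : ℝ)
    (g : (Fin S → 𝒴) → Fin S → ℝ) (p : (Fin (N * S) → ℝ) × (Fin (N * S) → 𝒴)) :
    gaussianBlock P (N * S) {x | metric g a p.2 x ≤ metric g a p.2 p.1} ≤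
      ENNReal.ofReal (Real.exp (pairwiseExponent P g a t p)) := by
  simp only [pairwiseExponent, metric_eq_sum, zero_mul, sub_zero]
  exact gaussianBlock_sum_sub_mul_sq_le P ht a _ _

variable [MeasurableSpace 𝒴] {g : (Fin S → 𝒴) → Fin S → ℝ}

lemma measurable_metric (hg : Measurable g) (a : ℝ) :
    Measurable fun p : (Fin (N * S) → ℝ) × (Fin (N * S) → 𝒴) => metric g a p.2 p.1 := by
  have hsymbol : ∀ n : Fin N, Measurable fun p : (Fin (N * S) → ℝ) × (Fin (N * S) → 𝒴) =>
      superSymbol p.2 n := fun n =>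
    measurable_pi_lambda _ fun s => (measurable_pi_apply _).comp measurable_snd
  refine Finset.measurable_sum _ fun n _ => Finset.measurable_sum _ fun s _ => ?_
  exact (((measurable_pi_apply s).comp (hg.comp (hsymbol n))).sub
    (((measurable_pi_apply _).comp measurable_fst).const_mul a)).pow_const 2

lemma measurable_pairwiseExponent (P : ℝ≥0) (hg : Measurable g) (a t : ℝ) :
    Measurable (pairwiseExponent P (N := N) g a t) :=
  (((measurable_metric hg a).const_mul t).sub ((measurable_metric hg 0).const_mul _)).sub_const _

lemma lintegral_isError_le (P : ℝ≥0) {M : ℕ} (κ : Kernel (Fin (N * S) → ℝ) (Fin (N * S) → 𝒴))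
    [IsMarkovKernel κ] (hg : Measurable g) (a r : ℝ) {t : ℝ} (ht : 0 ≤ t) (m : Fin M) :
    ∫⁻ c, κ (c m) {y | IsError g a c m y} ∂(Measure.pi fun _ : Fin M => gaussianBlock P (N * S)) ≤
      (gaussianBlock P (N * S) ⊗ₘ κ) {p | -r < pairwiseExponent P g a t p} +
        M * ENNReal.ofReal (Real.exp (-r)) := by
  have hA : MeasurableSet {p | pairwiseExponent P (N := N) g a t p ≤ -r} :=
    measurableSet_le (measurable_pairwiseExponent P hg a t) measurable_const
  have hbound := lintegral_exists_ne_le_le (κ := κ) hA (measurable_metric hg a) (fun p hp =>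
    (gaussianBlock_metric_le P ht a g p).trans
      (ENNReal.ofReal_le_ofReal (Real.exp_le_exp.2 hp))) m
  simpa only [IsError, Set.compl_ofPred, not_le, Fintype.card_fin] using hbound

theorem averageError_le (P : ℝ≥0) (W : ∀ n, Kernel (Fin n → ℝ) (Fin n → 𝒴))
    [∀ n, IsMarkovKernel (W n)] (hg : Measurable g) (a R r : ℝ) {t : ℝ} (ht : 0 ≤ t) :
    averageError P W S g a R N ≤
      jointLaw P W (N * S) {p | -r < pairwiseExponent P g a t p} +
        numMessages N S R * ENNReal.ofReal (Real.exp (-r)) := by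
  have hM : (numMessages N S R : ℝ≥0∞) ≠ 0 :=
    Nat.cast_ne_zero.2 (Nat.ceil_pos.2 (Real.exp_pos _)).ne'
  calc averageError P W S g a R N
      ≤ (numMessages N S R : ℝ≥0∞)⁻¹ * ∑ _m : Fin (numMessages N S R),
        (jointLaw P W (N * S) {p | -r < pairwiseExponent P g a t p} +
          numMessages N S R * ENNReal.ofReal (Real.exp (-r))) := by
        unfold averageError
        gcongr with m
        exact lintegral_isError_le P (W (N * S)) hg a r ht m
    _ = _ := by
        rw [Finset.sum_const, Finset.card_univ, Fintype.card_fin, nsmul_eq_mul, ← mul_assoc,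
          ENNReal.inv_mul_cancel hM (ENNReal.natCast_ne_top _), one_mul]

lemma averageError_eq_zero_of_nonpos (P : ℝ≥0) (W : ∀ n, Kernel (Fin n → ℝ) (Fin n → 𝒴))
    (g : (Fin S → 𝒴) → Fin S → ℝ) (a : ℝ) {R : ℝ} (hR : R ≤ 0) :
    averageError P W S g a R N = 0 := by
  have hM : numMessages N S R ≤ 1 := by
    refine Nat.ceil_le.2 ?_
    rw [Nat.cast_one, Real.exp_le_one_iff]
    exact mul_nonpos_of_nonneg_of_nonpos (by positivity) hR
  have := Fin.subsingleton_iff_le_one.2 hM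
  have hno_error : ∀ (c : Fin (numMessages N S R) → Fin (N * S) → ℝ) m,
      {y | IsError g a c m y} = ∅ := fun c m =>
    Set.eq_empty_of_forall_notMem fun y ⟨m', hne, _⟩ => hne (Subsingleton.elim m' m)
  simp [averageError, hno_error]

end NearestNeighbourDecoding

section Estimation

variable {𝒴 : Type*} [MeasurableSpace 𝒴]

lemma integral_mul_condExp_of_stronglyMeasurable {α : Type*} {m m₀ : MeasurableSpace α}
    {μ : Measure α} [IsFiniteMeasure μ] (hm : m ≤ m₀) {φ f : α → ℝ} (hφ : StronglyMeasurable[m] φ)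
    (hφf : Integrable (φ * f) μ) (hf : Integrable f μ) :
    ∫ ω, φ ω * μ[f|m] ω ∂μ = ∫ ω, φ ω * f ω ∂μ :=
  (integral_congr_ae (condExp_mul_of_stronglyMeasurable_left hφ hφf hf).symm).trans
    (integral_condExp hm)

lemma integral_sq_gaussianReal (P : ℝ≥0) : ∫ x, x ^ 2 ∂gaussianReal 0 P = P := by
  rw [← variance_of_integral_eq_zero (X := fun x => x) aemeasurable_id integral_id_gaussianReal]
  exact variance_id_gaussianReal

lemma shift_iterate {α : Type*} (j : ℕ) (ω : ℕ → α) (k : ℕ) : shift^[j] ω k = ω (j + k) := by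
  induction j generalizing ω with
  | zero => simp only [Function.iterate_zero, id_eq, zero_add]
  | succ j ih => rw [Function.iterate_succ_apply, ih, Nat.add_right_comm]; rfl

lemma measurable_segment (n : ℕ) : Measurable (segment (𝒴 := 𝒴) n) := by
  unfold segment
  fun_prop

/-- The estimate of the `k`-th input from the first `S` outputs of an input/output sequence. -/
noncomputable def estimate {S : ℕ} (g : (Fin S → 𝒴) → Fin S → ℝ) (k : Fin S)
    (ω : ℕ → ℝ × 𝒴) : ℝ :=
  g (segment S ω).2 k

/-- The second moment of the estimate of the `k`-th input from the first `S` outputs. -/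
noncomputable def estimatePower {S : ℕ} (μ : Measure (ℕ → ℝ × 𝒴)) (g : (Fin S → 𝒴) → Fin S → ℝ)
    (k : Fin S) : ℝ :=
  ∫ ω, estimate g k ω ^ 2 ∂μ

/-- The power per symbol of the estimate of a super symbol of length `S`. -/
noncomputable def meanPower {S : ℕ} (μ : Measure (ℕ → ℝ × 𝒴)) (g : (Fin S → 𝒴) → Fin S → ℝ) : ℝ :=
  (∑ k, estimatePower μ g k) / S

/-- The contribution of the `k`-th symbol of the first super symbol to the decoding metric of the
transmitted codeword. -/
noncomputable def squaredError {S : ℕ} (g : (Fin S → 𝒴) → Fin S → ℝ) (a : ℝ) (k : Fin S)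
    (ω : ℕ → ℝ × 𝒴) : ℝ :=
  (estimate g k ω - a * (ω k).1) ^ 2

variable {P : ℝ≥0} {W : ∀ n, Kernel (Fin n → ℝ) (Fin n → 𝒴)} {μ : Measure (ℕ → ℝ × 𝒴)} {S L : ℕ}
  {g : (Fin S → 𝒴) → Fin S → ℝ} {h : (Fin L → 𝒴) → Fin L → ℝ} {k : Fin S}

lemma estimatePower_nonneg : 0 ≤ estimatePower μ g k :=
  integral_nonneg fun _ => sq_nonneg _

lemma meanPower_nonneg : 0 ≤ meanPower μ g :=
  div_nonneg (Finset.sum_nonneg fun _ _ => estimatePower_nonneg) S.cast_nonneg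

lemma sum_estimatePower (μ : Measure (ℕ → ℝ × 𝒴)) (g : (Fin S → 𝒴) → Fin S → ℝ) :
    ∑ k, estimatePower μ g k = S * meanPower μ g := by
  rcases eq_or_ne S 0 with rfl | hS
  · simp only [Finset.univ_eq_empty, Finset.sum_empty, Nat.cast_zero, zero_mul]
  · rw [meanPower, mul_div_cancel₀ _ (Nat.cast_ne_zero.2 hS)]

lemma IsStationaryErgodic.measurePreserving_segment (hμ : IsStationaryErgodic P W μ) (n : ℕ) :
    MeasurePreserving (segment n) μ (jointLaw P W n) :=
  ⟨measurable_segment n, hμ.map_segment n⟩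

variable [∀ n, IsMarkovKernel (W n)]

instance (n : ℕ) : IsProbabilityMeasure (jointLaw P W n) := by
  unfold jointLaw
  infer_instance

lemma measurePreserving_fst_apply (i : Fin S) :
    MeasurePreserving (fun p : (Fin S → ℝ) × (Fin S → 𝒴) => p.1 i) (jointLaw P W S)
      (gaussianReal 0 P) :=
  (measurePreserving_eval (fun _ : Fin S => gaussianReal 0 P) i).comp
    ⟨measurable_fst, Measure.fst_compProd (gaussianBlock P S) (W S)⟩

lemma memLp_fst_apply (i : Fin S) {p : ℝ≥0∞} (hp : p ≠ ∞) :
    MemLp (fun q : (Fin S → ℝ) × (Fin S → 𝒴) => q.1 i) p (jointLaw P W S) :=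
  (memLp_id_gaussianReal' p hp).comp_measurePreserving (measurePreserving_fst_apply i)

lemma memLp_condMean (i : Fin S) {p : ℝ≥0∞} (hp1 : 1 ≤ p) (hp : p ≠ ∞) :
    MemLp (condMean P W S i) p (jointLaw P W S) :=
  (memLp_fst_apply i hp).condExp hp1

lemma IsMMSESmoother.integral_mul_fst_eq (hg : IsMMSESmoother P W S g) (i : Fin S)
    {φ : (Fin S → 𝒴) → ℝ} (hφ : Measurable φ)
    (hφ2 : MemLp (fun p : (Fin S → ℝ) × (Fin S → 𝒴) => φ p.2) 2 (jointLaw P W S)) :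
    ∫ p, φ p.2 * p.1 i ∂jointLaw P W S = ∫ p, φ p.2 * g p.2 i ∂jointLaw P W S := by
  have hx : MemLp (fun p : (Fin S → ℝ) × (Fin S → 𝒴) => p.1 i) 2 (jointLaw P W S) :=
    memLp_fst_apply i ENNReal.ofNat_ne_top
  have hφm : StronglyMeasurable[outputSigma 𝒴 S] fun p : (Fin S → ℝ) × (Fin S → 𝒴) => φ p.2 :=
    (hφ.comp (comap_measurable _)).stronglyMeasurable
  rw [← integral_mul_condExp_of_stronglyMeasurable measurable_snd.comap_le hφm
    (hφ2.integrable_mul hx) (hx.integrable one_le_two)]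
  refine integral_congr_ae ?_
  filter_upwards [hg.ae_eq i] with p hp
  rw [hp, condMean]

namespace IsStationaryErgodic

lemma measurePreserving_input (hμ : IsStationaryErgodic P W μ) (k : ℕ) :
    MeasurePreserving (fun ω : ℕ → ℝ × 𝒴 => (ω k).1) μ (gaussianReal 0 P) :=
  (measurePreserving_fst_apply (Fin.last k)).comp (hμ.measurePreserving_segment (k + 1))

lemma memLp_input (hμ : IsStationaryErgodic P W μ) (k : ℕ) {p : ℝ≥0∞} (hp : p ≠ ∞) :
    MemLp (fun ω : ℕ → ℝ × 𝒴 => (ω k).1) p μ :=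
  (memLp_id_gaussianReal' p hp).comp_measurePreserving (hμ.measurePreserving_input k)

lemma integral_input_sq (hμ : IsStationaryErgodic P W μ) (k : ℕ) :
    ∫ ω, (ω k).1 ^ 2 ∂μ = P :=
  ((hμ.measurePreserving_input k).hasLaw.integral_comp (f := fun x => x ^ 2)
    (by fun_prop)).trans (integral_sq_gaussianReal P)

lemma memLp_estimate (hμ : IsStationaryErgodic P W μ) (hg : IsMMSESmoother P W S g) (k : Fin S)
    {p : ℝ≥0∞} (hp1 : 1 ≤ p) (hp : p ≠ ∞) : MemLp (estimate g k) p μ :=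
  ((memLp_congr_ae (hg.ae_eq k)).2 (memLp_condMean k hp1 hp)).comp_measurePreserving
    (hμ.measurePreserving_segment S)

lemma memLp_estimate_shift (hμ : IsStationaryErgodic P W μ) (hg : IsMMSESmoother P W S g)
    (j : ℕ) (k : Fin S) {p : ℝ≥0∞} (hp1 : 1 ≤ p) (hp : p ≠ ∞) :
    MemLp (fun ω => estimate g k (shift^[j] ω)) p μ :=
  (hμ.memLp_estimate hg k hp1 hp).comp_measurePreserving
    (hμ.ergodic.toMeasurePreserving.iterate j)

lemma integral_mul_input_eq (hμ : IsStationaryErgodic P W μ) (hg : IsMMSESmoother P W S g)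
    (k : Fin S) {φ : (Fin S → 𝒴) → ℝ} (hφ : Measurable φ)
    (hφ2 : MemLp (fun ω : ℕ → ℝ × 𝒴 => φ (segment S ω).2) 2 μ) :
    ∫ ω, φ (segment S ω).2 * (ω k).1 ∂μ = ∫ ω, φ (segment S ω).2 * estimate g k ω ∂μ := by
  have hseg := hμ.measurePreserving_segment S
  have hφ2' : MemLp (fun p : (Fin S → ℝ) × (Fin S → 𝒴) => φ p.2) 2 (jointLaw P W S) := by
    rw [← hseg.map_eq]
    exact (memLp_map_measure_iff (hφ.comp measurable_snd).aestronglyMeasurable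
      hseg.measurable.aemeasurable).2 hφ2
  have hgm := hg.measurable
  calc ∫ ω, φ (segment S ω).2 * (ω k).1 ∂μ
      = ∫ p, φ p.2 * p.1 k ∂jointLaw P W S :=
        hseg.hasLaw.integral_comp (f := fun p => φ p.2 * p.1 k) (by fun_prop)
    _ = ∫ p, φ p.2 * g p.2 k ∂jointLaw P W S := hg.integral_mul_fst_eq k hφ hφ2'
    _ = ∫ ω, φ (segment S ω).2 * estimate g k ω ∂μ :=
        (hseg.hasLaw.integral_comp (f := fun p => φ p.2 * g p.2 k) (by fun_prop)).symm

lemma integral_estimate_mul_input (hμ : IsStationaryErgodic P W μ)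
    (hg : IsMMSESmoother P W S g) (k : Fin S) :
    ∫ ω, estimate g k ω * (ω k).1 ∂μ = estimatePower μ g k := by
  simp only [estimatePower, sq]
  exact hμ.integral_mul_input_eq hg k ((measurable_pi_apply k).comp hg.measurable)
    (hμ.memLp_estimate hg k one_le_two ENNReal.ofNat_ne_top)

lemma integrable_squaredError (hμ : IsStationaryErgodic P W μ) (hg : IsMMSESmoother P W S g)
    (a : ℝ) (k : Fin S) : Integrable (squaredError g a k) μ :=
  ((hμ.memLp_estimate hg k one_le_two ENNReal.ofNat_ne_top).sub
    ((hμ.memLp_input k ENNReal.ofNat_ne_top).const_mul a)).integrable_sq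

lemma integral_squaredError (hμ : IsStationaryErgodic P W μ) (hg : IsMMSESmoother P W S g)
    (a : ℝ) (k : Fin S) :
    ∫ ω, squaredError g a k ω ∂μ = (1 - 2 * a) * estimatePower μ g k + a ^ 2 * P := by
  have hcross : ∀ ω : ℕ → ℝ × 𝒴,
      a * (ω k).1 * estimate g k ω = a * (estimate g k ω * (ω k).1) := fun ω => by ring
  simp only [squaredError]
  rw [integral_sub_sq (hμ.memLp_estimate hg k one_le_two ENNReal.ofNat_ne_top)
    ((hμ.memLp_input k ENNReal.ofNat_ne_top).const_mul a)]
  simp only [hcross, mul_pow, integral_const_mul, hμ.integral_input_sq,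
    hμ.integral_estimate_mul_input hg]
  rw [← estimatePower]
  ring

lemma estimatePower_le (hμ : IsStationaryErgodic P W μ) (hg : IsMMSESmoother P W S g)
    (k : Fin S) : estimatePower μ g k ≤ P := by
  have herror : 0 ≤ ∫ ω, squaredError g 1 k ω ∂μ := integral_nonneg fun _ => sq_nonneg _
  rw [hμ.integral_squaredError hg] at herror
  linarith

lemma meanPower_le (hμ : IsStationaryErgodic P W μ) (hg : IsMMSESmoother P W S g) :
    meanPower μ g ≤ P := by
  refine div_le_of_le_mul₀ S.cast_nonneg P.2 ?_
  calc ∑ k, estimatePower μ g k ≤ ∑ _k : Fin S, (P : ℝ) :=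
        Finset.sum_le_sum fun k _ => hμ.estimatePower_le hg k
    _ = P * S := by
        rw [Finset.sum_const, Finset.card_univ, Fintype.card_fin, nsmul_eq_mul, mul_comm]

lemma integral_estimate_shift_mul_estimate (hμ : IsStationaryErgodic P W μ)
    (hg : IsMMSESmoother P W S g) (hh : IsMMSESmoother P W L h) {j : ℕ} {k : Fin L} {i : Fin S}
    (hi : (i : ℕ) = j + k) (hj : j + L ≤ S) :
    ∫ ω, estimate h k (shift^[j] ω) * estimate g i ω ∂μ = estimatePower μ h k := by
  have hwindow : ∀ ω : ℕ → ℝ × 𝒴, estimate h k (shift^[j] ω) =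
      h (fun l => (segment S ω).2 ⟨j + l, by omega⟩) k := fun ω => by
    simp only [estimate, segment, shift_iterate]
  have hφ : Measurable fun y : Fin S → 𝒴 => h (fun l => y ⟨j + l, by omega⟩) k := by
    have := hh.measurable
    fun_prop
  have hφ2 := hμ.memLp_estimate_shift hh j k one_le_two ENNReal.ofNat_ne_top
  have hT := hμ.ergodic.toMeasurePreserving.iterate j
  have hint : Integrable (fun ω => estimate h k ω * (ω k).1) μ :=
    (hμ.memLp_estimate hh k one_le_two ENNReal.ofNat_ne_top).integrable_mul
      (hμ.memLp_input (p := 2) k ENNReal.ofNat_ne_top)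
  calc ∫ ω, estimate h k (shift^[j] ω) * estimate g i ω ∂μ
      = ∫ ω, estimate h k (shift^[j] ω) * (ω i).1 ∂μ := by
        simp only [hwindow] at hφ2 ⊢
        exact (hμ.integral_mul_input_eq hg i hφ hφ2).symm
    _ = ∫ ω, estimate h k (shift^[j] ω) * (shift^[j] ω k).1 ∂μ := by
        simp only [shift_iterate, hi]
    _ = ∫ ω, estimate h k ω * (ω k).1 ∂μ := hT.hasLaw.integral_comp hint.aestronglyMeasurable
    _ = estimatePower μ h k := hμ.integral_estimate_mul_input hh k

lemma integral_estimate_sub_estimate_shift_sq (hμ : IsStationaryErgodic P W μ)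
    (hg : IsMMSESmoother P W S g) (hh : IsMMSESmoother P W L h) {j : ℕ} {k : Fin L} {i : Fin S}
    (hi : (i : ℕ) = j + k) (hj : j + L ≤ S) :
    ∫ ω, (estimate g i ω - estimate h k (shift^[j] ω)) ^ 2 ∂μ =
      estimatePower μ g i - estimatePower μ h k := by
  have hpower : ∫ ω, estimate h k (shift^[j] ω) ^ 2 ∂μ = estimatePower μ h k :=
    (hμ.ergodic.toMeasurePreserving.iterate j).hasLaw.integral_comp
      (hμ.memLp_estimate hh k one_le_two ENNReal.ofNat_ne_top).integrable_sq.aestronglyMeasurable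
  rw [integral_sub_sq (hμ.memLp_estimate hg i one_le_two ENNReal.ofNat_ne_top)
      (hμ.memLp_estimate_shift hh j k one_le_two ENNReal.ofNat_ne_top),
    hμ.integral_estimate_shift_mul_estimate hg hh hi hj, hpower, ← estimatePower]
  ring

lemma integral_fst_sub_condMean_sq (hμ : IsStationaryErgodic P W μ)
    (hg : IsMMSESmoother P W S g) (i : Fin S) :
    ∫ p, (p.1 i - condMean P W S i p) ^ 2 ∂jointLaw P W S = P - estimatePower μ g i := by
  have hgm := hg.measurable
  calc ∫ p, (p.1 i - condMean P W S i p) ^ 2 ∂jointLaw P W S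
      = ∫ p, (g p.2 i - 1 * p.1 i) ^ 2 ∂jointLaw P W S := by
        refine integral_congr_ae ?_
        filter_upwards [hg.ae_eq i] with p hp
        rw [← hp, one_mul, sub_sq_comm]
    _ = ∫ ω, squaredError g 1 i ω ∂μ :=
        ((hμ.measurePreserving_segment S).hasLaw.integral_comp
          (f := fun p => (g p.2 i - 1 * p.1 i) ^ 2) (by fun_prop)).symm
    _ = P - estimatePower μ g i := by
        rw [hμ.integral_squaredError hg]
        ring

lemma normalizedMMSE_eq (hμ : IsStationaryErgodic P W μ) (hg : IsMMSESmoother P W S g)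
    (hS : S ≠ 0) : normalizedMMSE P W S = P - meanPower μ g := by
  have hint : ∀ i : Fin S,
      Integrable (fun p => (p.1 i - condMean P W S i p) ^ 2) (jointLaw P W S) := fun i =>
    ((memLp_fst_apply i ENNReal.ofNat_ne_top).sub
      (memLp_condMean i one_le_two ENNReal.ofNat_ne_top)).integrable_sq
  have hS' : (S : ℝ) ≠ 0 := Nat.cast_ne_zero.2 hS
  rw [normalizedMMSE, integral_finsetSum _ fun i _ => hint i]
  simp only [hμ.integral_fst_sub_condMean_sq hg, Finset.sum_sub_distrib, Finset.sum_const,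
    Finset.card_univ, Fintype.card_fin, nsmul_eq_mul, sum_estimatePower]
  field_simp

lemma scaling_eq (hμ : IsStationaryErgodic P W μ) (hg : IsMMSESmoother P W S g) :
    scaling P W S g = meanPower μ g / P := by
  have hgm := hg.measurable
  have hint : ∀ i : Fin S, Integrable (fun ω => estimate g i ω * (ω i).1) μ := fun i =>
    (hμ.memLp_estimate hg i one_le_two ENNReal.ofNat_ne_top).integrable_mul
      (hμ.memLp_input (p := 2) i ENNReal.ofNat_ne_top)
  have hcorrelation : ∫ p, ∑ i, p.1 i * g p.2 i ∂jointLaw P W S = ∑ i, estimatePower μ g i :=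
    calc ∫ p, ∑ i, p.1 i * g p.2 i ∂jointLaw P W S
        = ∫ ω, ∑ i : Fin S, (ω i).1 * estimate g i ω ∂μ :=
          ((hμ.measurePreserving_segment S).hasLaw.integral_comp
            (f := fun p => ∑ i, p.1 i * g p.2 i) (by fun_prop)).symm
      _ = ∫ ω, ∑ i : Fin S, estimate g i ω * (ω i).1 ∂μ := by simp only [mul_comm]
      _ = ∑ i, estimatePower μ g i := by
          rw [integral_finsetSum _ fun i _ => hint i]
          exact Finset.sum_congr rfl fun i _ => hμ.integral_estimate_mul_input hg i
  rw [scaling, hcorrelation, ← div_div, ← meanPower]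

lemma scaling_mem_Icc (hμ : IsStationaryErgodic P W μ) (hg : IsMMSESmoother P W S g) :
    scaling P W S g ∈ Set.Icc 0 1 := by
  rw [hμ.scaling_eq hg]
  exact ⟨div_nonneg meanPower_nonneg P.2, div_le_one_of_le₀ (hμ.meanPower_le hg) P.2⟩

end IsStationaryErgodic

end Estimation

section Concentration

variable {𝒴 : Type*}

/-- The decoding metric of the transmitted codeword on the first super symbol. -/
noncomputable def loss {S : ℕ} (g : (Fin S → 𝒴) → Fin S → ℝ) (a : ℝ) (ω : ℕ → ℝ × 𝒴) : ℝ :=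
  ∑ k, squaredError g a k ω

lemma metric_segment {S : ℕ} (g : (Fin S → 𝒴) → Fin S → ℝ) (a : ℝ) (N : ℕ) (ω : ℕ → ℝ × 𝒴) :
    metric g a (segment (N * S) ω).2 (segment (N * S) ω).1 =
      birkhoffSum shift^[S] (loss g a) N ω := by
  have hindex : ∀ (n : Fin N) (s : Fin S),
      ((finProdFinEquiv (n, s) : Fin (N * S)) : ℕ) = S * n + s := fun n s => Nat.add_comm _ _
  have houtput : ∀ n : Fin N,
      superSymbol (fun i : Fin (N * S) => (ω i).2) n = fun s : Fin S => (ω (S * n + s)).2 :=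
    fun n => funext fun s => by rw [superSymbol, hindex]
  simp only [metric, birkhoffSum, Finset.sum_range, loss, squaredError, estimate, segment,
    houtput, superSymbol, hindex, ← Function.iterate_mul, shift_iterate]

variable [MeasurableSpace 𝒴] {P : ℝ≥0} {W : ∀ n, Kernel (Fin n → ℝ) (Fin n → 𝒴)}
  {μ : Measure (ℕ → ℝ × 𝒴)} {S L : ℕ}

lemma exists_meanPower_le_estimatePower (μ : Measure (ℕ → ℝ × 𝒴)) (g : (Fin S → 𝒴) → Fin S → ℝ)
    (hS : S ≠ 0) : ∃ k, meanPower μ g ≤ estimatePower μ g k := by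
  have := Fin.pos_iff_nonempty.1 (Nat.pos_of_ne_zero hS)
  obtain ⟨k, -, hk⟩ := Finset.exists_le_of_sum_le (f := fun _ : Fin S => meanPower μ g)
    (g := estimatePower μ g) Finset.univ_nonempty (by
      rw [sum_estimatePower, Finset.sum_const, Finset.card_univ, Fintype.card_fin, nsmul_eq_mul])
  exact ⟨k, hk⟩

lemma card_filter_lt_add_le (S L : ℕ) : ({j : Fin S | S < j + L} : Finset (Fin S)).card ≤ L := by
  calc ({j : Fin S | S < j + L} : Finset (Fin S)).card
      ≤ (Finset.range L).card := by
        refine Finset.card_le_card_of_injOn (fun j : Fin S => S - 1 - (j : ℕ)) (fun j hj => ?_)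
          fun i _ j _ hij => Fin.ext (by simp only at hij; lia)
        simp only [Finset.coe_filter, Finset.mem_univ, true_and, Set.mem_ofPred_eq] at hj
        exact Finset.mem_coe.2 (Finset.mem_range.2 (by lia))
    _ = L := Finset.card_range L

variable [∀ n, IsMarkovKernel (W n)]

namespace IsStationaryErgodic

section SuperSymbol

variable {g : (Fin S → 𝒴) → Fin S → ℝ} {h : (Fin L → 𝒴) → Fin L → ℝ}

lemma memLp_squaredError (hμ : IsStationaryErgodic P W μ) (hg : IsMMSESmoother P W S g) (a : ℝ)
    (k : Fin S) : MemLp (squaredError g a k) 2 μ :=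
  memLp_sq ((hμ.memLp_estimate hg k (by norm_num) ENNReal.ofNat_ne_top).sub
    ((hμ.memLp_input k ENNReal.ofNat_ne_top).const_mul a))

lemma memLp_loss (hμ : IsStationaryErgodic P W μ) (hg : IsMMSESmoother P W S g) (a : ℝ) :
    MemLp (loss g a) 2 μ :=
  memLp_finsetSum _ fun k _ => hμ.memLp_squaredError hg a k

lemma integrable_loss (hμ : IsStationaryErgodic P W μ) (hg : IsMMSESmoother P W S g) (a : ℝ) :
    Integrable (loss g a) μ :=
  integrable_finsetSum _ fun k _ => hμ.integrable_squaredError hg a k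

lemma integral_loss (hμ : IsStationaryErgodic P W μ) (hg : IsMMSESmoother P W S g) (a : ℝ) :
    ∫ ω, loss g a ω ∂μ = S * ((1 - 2 * a) * meanPower μ g + a ^ 2 * P) := by
  simp only [loss]
  rw [integral_finsetSum _ fun k _ => hμ.integrable_squaredError hg a k]
  simp only [hμ.integral_squaredError hg, Finset.sum_add_distrib, ← Finset.mul_sum,
    sum_estimatePower, Finset.sum_const, Finset.card_univ, Fintype.card_fin, nsmul_eq_mul]
  ring

lemma integral_squaredError_le (hμ : IsStationaryErgodic P W μ) (hg : IsMMSESmoother P W S g)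
    {a : ℝ} (ha : a ∈ Set.Icc 0 1) (k : Fin S) : ∫ ω, squaredError g a k ω ∂μ ≤ P := by
  have hpower := hμ.estimatePower_le hg k
  calc ∫ ω, squaredError g a k ω ∂μ
      = (1 - a) ^ 2 * estimatePower μ g k + a ^ 2 * (P - estimatePower μ g k) := by
        rw [hμ.integral_squaredError hg]
        ring
    _ ≤ 1 * estimatePower μ g k + 1 * (P - estimatePower μ g k) := by
        gcongr
        · exact estimatePower_nonneg
        · exact pow_le_one₀ (sub_nonneg.2 ha.2) (sub_le_self 1 ha.1)
        · exact pow_le_one₀ ha.1 ha.2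
    _ = P := by ring

lemma integral_squaredError_shift (hμ : IsStationaryErgodic P W μ) (hg : IsMMSESmoother P W S g)
    (a : ℝ) (k : Fin S) (j : ℕ) :
    ∫ ω, squaredError g a k (shift^[j] ω) ∂μ = ∫ ω, squaredError g a k ω ∂μ :=
  (hμ.ergodic.toMeasurePreserving.iterate j).hasLaw.integral_comp
    (hμ.integrable_squaredError hg a k).aestronglyMeasurable

lemma integrable_squaredError_shift (hμ : IsStationaryErgodic P W μ)
    (hg : IsMMSESmoother P W S g) (a : ℝ) (k : Fin S) (j : ℕ) :
    Integrable (fun ω => squaredError g a k (shift^[j] ω)) μ :=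
  (hμ.ergodic.toMeasurePreserving.iterate j).integrable_comp_of_integrable
    (hμ.integrable_squaredError hg a k)

lemma integral_abs_squaredError_sub_shift_le (hμ : IsStationaryErgodic P W μ)
    (hg : IsMMSESmoother P W S g) (hh : IsMMSESmoother P W L h) {a : ℝ} (ha : a ∈ Set.Icc 0 1)
    {η : ℝ} (hη : 0 < η) {j : ℕ} {k : Fin L} {i : Fin S} (hi : (i : ℕ) = j + k)
    (hj : j + L ≤ S) :
    ∫ ω, |squaredError g a i ω - squaredError h a k (shift^[j] ω)| ∂μ ≤
      (estimatePower μ g i - estimatePower μ h k) / (2 * η) + η * (2 * P) := by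
  have hx : MemLp (fun ω : ℕ → ℝ × 𝒴 => a * (ω i).1) 2 μ :=
    (hμ.memLp_input i ENNReal.ofNat_ne_top).const_mul a
  have hshift : ∀ ω, squaredError h a k (shift^[j] ω) =
      (estimate h k (shift^[j] ω) - a * (ω i).1) ^ 2 := fun ω => by
    rw [squaredError, shift_iterate, hi]
  have hbound := integral_abs_sq_sub_sq_le
    ((hμ.memLp_estimate hg i one_le_two ENNReal.ofNat_ne_top).sub hx)
    ((hμ.memLp_estimate_shift hh j k one_le_two ENNReal.ofNat_ne_top).sub hx) hη
  simp only [Pi.sub_apply, sub_sub_sub_cancel_right, ← hshift,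
    hμ.integral_estimate_sub_estimate_shift_sq hg hh hi hj,
    hμ.integral_squaredError_shift hh] at hbound
  refine hbound.trans ?_
  gcongr
  linarith [hμ.integral_squaredError_le hg ha i, hμ.integral_squaredError_le hh ha k,
    show ∫ ω, squaredError g a i ω ∂μ = ∫ ω, (estimate g i ω - a * (ω i).1) ^ 2 ∂μ from rfl]

lemma integral_abs_squaredError_sub_shift_le_two_mul (hμ : IsStationaryErgodic P W μ)
    (hg : IsMMSESmoother P W S g) (hh : IsMMSESmoother P W L h) {a : ℝ} (ha : a ∈ Set.Icc 0 1)
    (i : Fin S) (j : ℕ) (k : Fin L) :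
    ∫ ω, |squaredError g a i ω - squaredError h a k (shift^[j] ω)| ∂μ ≤ 2 * P := by
  have hi := hμ.integrable_squaredError hg a i
  have hk := hμ.integrable_squaredError_shift hh a k j
  calc ∫ ω, |squaredError g a i ω - squaredError h a k (shift^[j] ω)| ∂μ
      ≤ ∫ ω, (squaredError g a i ω + squaredError h a k (shift^[j] ω)) ∂μ :=
        integral_mono (hi.sub hk).abs (hi.add hk) fun ω =>
          abs_sub_le_iff.2 ⟨by
            linarith [show 0 ≤ squaredError h a k (shift^[j] ω) from sq_nonneg _], by
            linarith [show 0 ≤ squaredError g a i ω from sq_nonneg _]⟩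
    _ ≤ 2 * P := by
        rw [integral_add hi hk, hμ.integral_squaredError_shift hh]
        linarith [hμ.integral_squaredError_le hg ha i, hμ.integral_squaredError_le hh ha k]

lemma integral_abs_squaredError_rotate_sub_shift_le [NeZero S] (hμ : IsStationaryErgodic P W μ)
    (hg : IsMMSESmoother P W S g) (hh : IsMMSESmoother P W L h) {a : ℝ} (ha : a ∈ Set.Icc 0 1)
    {η : ℝ} (hη : 0 < η) (k : Fin L) (j : Fin S) :
    ∫ ω, |squaredError g a (j + Fin.ofNat S k) ω - squaredError h a k (shift^[j] ω)| ∂μ ≤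
      (estimatePower μ g (j + Fin.ofNat S k) - estimatePower μ h k) / (2 * η) + η * (2 * P) +
        if S < j + L then 2 * P + P / (2 * η) else 0 := by
  split_ifs with hj
  · have hpower : -(P / (2 * η)) ≤
        (estimatePower μ g (j + Fin.ofNat S k) - estimatePower μ h k) / (2 * η) := by
      rw [← neg_div]
      gcongr
      linarith [hμ.estimatePower_le hh k,
        estimatePower_nonneg (μ := μ) (g := g) (k := j + Fin.ofNat S k)]
    have hηP : 0 ≤ η * (2 * P) := by positivity
    linarith [hμ.integral_abs_squaredError_sub_shift_le_two_mul hg hh ha (j + Fin.ofNat S k) j k]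
  · have hval : ((j + Fin.ofNat S k : Fin S) : ℕ) = j + k := by
      rw [Fin.val_add, Fin.val_ofNat, Nat.add_mod_mod, Nat.mod_eq_of_lt (by omega)]
    rw [add_zero]
    exact hμ.integral_abs_squaredError_sub_shift_le hg hh ha hη hval (not_lt.1 hj)

lemma integral_abs_loss_sub_birkhoffSum_le (hμ : IsStationaryErgodic P W μ)
    (hg : IsMMSESmoother P W S g) (hh : IsMMSESmoother P W L h) (hS : S ≠ 0) {a : ℝ}
    (ha : a ∈ Set.Icc 0 1) {η : ℝ} (hη : 0 < η) (k : Fin L) :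
    ∫ ω, |loss g a ω - birkhoffSum shift (squaredError h a k) S ω| ∂μ ≤
      S * ((meanPower μ g - estimatePower μ h k) / (2 * η) + η * (2 * P)) +
        L * (2 * P + P / (2 * η)) := by
  have : NeZero S := ⟨hS⟩
  have hrotate : ∀ φ : Fin S → ℝ, ∑ j : Fin S, φ (j + Fin.ofNat S k) = ∑ j, φ j :=
    fun φ => Equiv.sum_comp (Equiv.addRight (Fin.ofNat S k)) φ
  calc ∫ ω, |loss g a ω - birkhoffSum shift (squaredError h a k) S ω| ∂μ
      = ∫ ω, ‖∑ j : Fin S, (squaredError g a (j + Fin.ofNat S k) ω -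
          squaredError h a k (shift^[j] ω))‖ ∂μ := by
        refine integral_congr_ae (ae_of_all _ fun ω => ?_)
        simp only [loss, birkhoffSum, Finset.sum_range, Finset.sum_sub_distrib,
          hrotate fun i => squaredError g a i ω, Real.norm_eq_abs]
    _ ≤ ∑ j : Fin S, ∫ ω, |squaredError g a (j + Fin.ofNat S k) ω -
          squaredError h a k (shift^[j] ω)| ∂μ :=
        integral_norm_sum_le _ fun j _ => (hμ.integrable_squaredError hg a _).sub
          (hμ.integrable_squaredError_shift hh a k j)
    _ ≤ ∑ j : Fin S, ((estimatePower μ g (j + Fin.ofNat S k) - estimatePower μ h k) / (2 * η) +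
          η * (2 * P) + if S < j + L then 2 * P + P / (2 * η) else 0) :=
        Finset.sum_le_sum fun j _ =>
          hμ.integral_abs_squaredError_rotate_sub_shift_le hg hh ha hη k j
    _ = S * ((meanPower μ g - estimatePower μ h k) / (2 * η) + η * (2 * P)) +
          ({j : Fin S | S < j + L} : Finset (Fin S)).card * (2 * P + P / (2 * η)) := by
        rw [Finset.sum_add_distrib, Finset.sum_add_distrib, ← Finset.sum_div,
          Finset.sum_sub_distrib, hrotate (estimatePower μ g), sum_estimatePower,
          ← Finset.sum_filter]
        simp only [Finset.sum_const, Finset.card_univ, Fintype.card_fin, nsmul_eq_mul]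
        ring
    _ ≤ S * ((meanPower μ g - estimatePower μ h k) / (2 * η) + η * (2 * P)) +
          L * (2 * P + P / (2 * η)) := by
        gcongr
        exact card_filter_lt_add_le S L

end SuperSymbol

variable {g : ∀ S, (Fin S → 𝒴) → Fin S → ℝ} {q : ℝ}

lemma exists_eventually_integral_abs_loss_sub_birkhoffSum_le (hμ : IsStationaryErgodic P W μ)
    (hg : ∀ S, IsMMSESmoother P W S (g S))
    (hq : Tendsto (fun S => meanPower μ (g S)) atTop (𝓝 q)) {δ : ℝ} (hδ : 0 < δ) :
    ∃ (L : ℕ) (k : Fin L), ∀ᶠ S : ℕ in atTop, ∀ a ∈ Set.Icc (0 : ℝ) 1,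
      ∫ ω, |loss (g S) a ω - birkhoffSum shift (squaredError (g L) a k) S ω| ∂μ ≤ S * δ := by
  obtain ⟨η, hη, hηP⟩ : ∃ η : ℝ, 0 < η ∧ η * (2 * P) ≤ δ / 2 := by
    refine ⟨δ / (4 * (P + 1)), by positivity, ?_⟩
    rw [div_mul_eq_mul_div, div_le_div_iff₀ (by positivity) (by positivity)]
    nlinarith [P.2]
  obtain ⟨L, hL, hqL⟩ := ((eventually_ne_atTop 0).and
    (hq.eventually_const_lt (sub_lt_self q (mul_pos hη hδ)))).exists
  obtain ⟨k, hk⟩ := exists_meanPower_le_estimatePower μ (g L) hL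
  have hlimit : Tendsto (fun S : ℕ => (meanPower μ (g S) - estimatePower μ (g L) k) / (2 * η) +
      η * (2 * P) + L * (2 * P + P / (2 * η)) / S) atTop
      (𝓝 ((q - estimatePower μ (g L) k) / (2 * η) + η * (2 * P) + 0)) :=
    (((hq.sub_const _).div_const _).add_const _).add
      (tendsto_const_div_atTop_nhds_zero_nat _)
  have hlimit_lt : (q - estimatePower μ (g L) k) / (2 * η) + η * (2 * P) + 0 < δ := by
    have : (q - estimatePower μ (g L) k) / (2 * η) < δ / 2 := by
      rw [div_lt_div_iff₀ (by positivity) two_pos]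
      linarith
    linarith
  refine ⟨L, k, ?_⟩
  filter_upwards [hlimit.eventually_lt_const hlimit_lt, eventually_ne_atTop 0] with S hlt hS a ha
  have : (0 : ℝ) < S := Nat.cast_pos.2 (Nat.pos_of_ne_zero hS)
  calc ∫ ω, |loss (g S) a ω - birkhoffSum shift (squaredError (g L) a k) S ω| ∂μ
      ≤ S * ((meanPower μ (g S) - estimatePower μ (g L) k) / (2 * η) + η * (2 * P)) +
        L * (2 * P + P / (2 * η)) :=
        hμ.integral_abs_loss_sub_birkhoffSum_le (hg S) (hg L) hS ha hη k
    _ = S * ((meanPower μ (g S) - estimatePower μ (g L) k) / (2 * η) + η * (2 * P) +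
          L * (2 * P + P / (2 * η)) / S) := by field_simp
    _ ≤ S * δ := by gcongr

theorem eventually_birkhoffDeviation_loss_le (hμ : IsStationaryErgodic P W μ)
    (hg : ∀ S, IsMMSESmoother P W S (g S))
    (hq : Tendsto (fun S => meanPower μ (g S)) atTop (𝓝 q)) {δ : ℝ} (hδ : 0 < δ) :
    ∀ᶠ S : ℕ in atTop, ∀ a ∈ Set.Icc (0 : ℝ) 1, ∀ᶠ N : ℕ in atTop,
      birkhoffDeviation μ shift^[S] (loss (g S) a) N ≤ S * δ := by
  have := hμ.isProbabilityMeasure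
  obtain ⟨L, k, happrox⟩ :=
    hμ.exists_eventually_integral_abs_loss_sub_birkhoffSum_le hg hq (div_pos hδ three_pos)
  filter_upwards [happrox, eventually_gt_atTop 0] with S hS hS0 a ha
  have hdev : Tendsto (fun N => birkhoffDeviation μ shift (squaredError (g L) a k) (N * S)) atTop
      (𝓝 0) :=
    (tendsto_birkhoffDeviation hμ.ergodic (hμ.memLp_squaredError (hg L) a k)).comp
      (tendsto_id.atTop_mul_const' hS0)
  filter_upwards [hdev.eventually_le_const (div_pos hδ three_pos)] with N hN
  calc birkhoffDeviation μ shift^[S] (loss (g S) a) N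
      ≤ 2 * ∫ ω, |loss (g S) a ω - birkhoffSum shift (squaredError (g L) a k) S ω| ∂μ +
        S * birkhoffDeviation μ shift (squaredError (g L) a k) (N * S) :=
        birkhoffDeviation_iterate_le hμ.ergodic.toMeasurePreserving (hμ.integrable_loss (hg S) a)
          (hμ.integrable_squaredError (hg L) a k) S N
    _ ≤ 2 * (S * (δ / 3)) + S * (δ / 3) := by
        gcongr
        exact hS a ha
    _ = S * δ := by ring

end IsStationaryErgodic

end Concentration

section Achievability

variable {𝒴 : Type*} {P : ℝ≥0} {a b η γ R mmse : ℝ} {S : ℕ}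

/-- The Chernoff parameter `t` at scaling `a` for which `½ log (1 + 2 t a² P)`, the rate term of
`pairwiseExponent`, equals `-½ log (1 - b)`. -/
noncomputable def chernoffParameter (P : ℝ≥0) (a b : ℝ) : ℝ := b / (2 * a ^ 2 * P * (1 - b))

lemma chernoffParameter_nonneg (hb : b ∈ Set.Ioo 0 1) : 0 ≤ chernoffParameter P a b :=
  div_nonneg hb.1.le (mul_nonneg (by positivity) (sub_nonneg.2 hb.2.le))

lemma one_add_two_mul_chernoffParameter_mul (hP : 0 < P) (ha : a ≠ 0) (hb : b < 1) :
    1 + 2 * chernoffParameter P a b * a ^ 2 * P = (1 - b)⁻¹ := by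
  have hP' : (P : ℝ) ≠ 0 := NNReal.coe_ne_zero.2 hP.ne'
  have hb' : 1 - b ≠ 0 := (sub_pos.2 hb).ne'
  rw [chernoffParameter]
  field_simp
  ring

lemma two_mul_chernoffParameter_le (hb : b ∈ Set.Ioo 0 1) (hba : b ≤ a) :
    2 * chernoffParameter P a b ≤ 1 / (b * P * (1 - b)) := by
  have hb0 := hb.1
  have hb1 := sub_pos.2 hb.2
  have hratio : b ^ 2 / a ^ 2 ≤ 1 := by
    have := hb0.trans_le hba
    exact div_le_one_of_le₀ (by gcongr) (by positivity)
  calc 2 * chernoffParameter P a b = b ^ 2 / a ^ 2 * (1 / (b * P * (1 - b))) := by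
        rw [chernoffParameter]
        field_simp
    _ ≤ 1 * (1 / (b * P * (1 - b))) := by gcongr
    _ = 1 / (b * P * (1 - b)) := one_mul _

lemma chernoff_exponent_le (hP : 0 < P) (hb : b ∈ Set.Ioo 0 1) (hba : b ≤ a) (hη : 0 ≤ η)
    {d e s : ℝ} (hs : 0 ≤ s) (hd : d ≤ s * (a * P * (1 - a) + η)) (he : s * (a * P - η) ≤ e) :
    chernoffParameter P a b * d -
        chernoffParameter P a b / (1 + 2 * chernoffParameter P a b * a ^ 2 * P) * e -
        s * (Real.log (1 + 2 * chernoffParameter P a b * a ^ 2 * P) / 2) ≤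
      s * (Real.log (1 - b) / 2 + η / (b * P * (1 - b))) := by
  have ha : 0 < a := hb.1.trans_le hba
  have hb1 : 0 ≤ 1 - b := (sub_pos.2 hb.2).le
  have ht : 0 ≤ chernoffParameter P a b := chernoffParameter_nonneg hb
  rw [one_add_two_mul_chernoffParameter_mul hP ha.ne' hb.2, div_inv_eq_mul, Real.log_inv]
  have hmean : a * P * (1 - a) + η - (1 - b) * (a * P - η) ≤ 2 * η := by
    nlinarith [mul_nonneg (mul_nonneg ha.le P.coe_nonneg) (sub_nonneg.2 hba), mul_nonneg hb.1.le hη]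
  calc chernoffParameter P a b * d - chernoffParameter P a b * (1 - b) * e -
        s * (-Real.log (1 - b) / 2)
      = chernoffParameter P a b * (d - (1 - b) * e) + s * (Real.log (1 - b) / 2) := by ring
    _ ≤ chernoffParameter P a b *
          (s * (a * P * (1 - a) + η) - (1 - b) * (s * (a * P - η))) +
        s * (Real.log (1 - b) / 2) := by gcongr
    _ = s * (Real.log (1 - b) / 2 + chernoffParameter P a b *
          (a * P * (1 - a) + η - (1 - b) * (a * P - η))) := by ring
    _ ≤ s * (Real.log (1 - b) / 2 + chernoffParameter P a b * (2 * η)) := by gcongr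
    _ = s * (Real.log (1 - b) / 2 + η * (2 * chernoffParameter P a b)) := by ring
    _ ≤ s * (Real.log (1 - b) / 2 + η * (1 / (b * P * (1 - b)))) := by
        gcongr
        exact two_mul_chernoffParameter_le hb hba
    _ = s * (Real.log (1 - b) / 2 + η / (b * P * (1 - b))) := by rw [mul_one_div]

lemma metric_segment_eq_mul_birkhoffAverage (g : (Fin S → 𝒴) → Fin S → ℝ) (a : ℝ) (N : ℕ)
    (ω : ℕ → ℝ × 𝒴) :
    metric g a (segment (N * S) ω).2 (segment (N * S) ω).1 =
      N * birkhoffAverage ℝ shift^[S] (loss g a) N ω := by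
  rw [metric_segment, birkhoffAverage, smul_eq_mul]
  rcases eq_or_ne N 0 with rfl | hN
  · simp
  · rw [mul_inv_cancel_left₀ (Nat.cast_ne_zero.2 hN)]

lemma numMessages_le {N : ℕ} (hR : 0 ≤ R) :
    (numMessages N S R : ℝ) ≤ 2 * Real.exp (N * S * R) := by
  have hexp : 1 ≤ Real.exp (N * S * R) := Real.one_le_exp (by positivity)
  have hceil := (Nat.ceil_lt_add_one (Real.exp_nonneg (N * S * R))).le
  rw [numMessages]
  linarith

lemma numMessages_mul_exp_le {N : ℕ} (hR : 0 ≤ R) (γ : ℝ) :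
    numMessages N S R * ENNReal.ofReal (Real.exp (-(N * S * (R + γ)))) ≤
      ENNReal.ofReal (2 * Real.exp (-(N * S * γ))) := by
  rw [← ENNReal.ofReal_natCast, ← ENNReal.ofReal_mul (Nat.cast_nonneg _)]
  refine ENNReal.ofReal_le_ofReal ?_
  calc (numMessages N S R : ℝ) * Real.exp (-(N * S * (R + γ)))
      ≤ 2 * Real.exp (N * S * R) * Real.exp (-(N * S * (R + γ))) := by
        gcongr
        exact numMessages_le hR
    _ = 2 * Real.exp (-(N * S * γ)) := by
        rw [mul_assoc, ← Real.exp_add]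
        ring_nf

lemma lt_of_lt_gmiRate (hP : 0 < P) (hR : (R : EReal) < gmiRate P mmse) :
    mmse < P * Real.exp (-(2 * R)) := by
  have hP' : (0 : ℝ) < P := hP
  by_contra! hle
  have hmmse : 0 < mmse := lt_of_lt_of_le (by positivity) hle
  have hlog : ENNReal.log ((P : ℝ≥0∞) / ENNReal.ofReal mmse) = Real.log (P / mmse) := by
    rw [← ENNReal.ofReal_coe_nnreal, ← ENNReal.ofReal_div_of_pos hmmse, ENNReal.log_ofReal,
      if_neg (not_le.2 (by positivity))]
  rw [gmiRate, hlog, ← EReal.coe_mul, EReal.coe_lt_coe_iff] at hR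
  have : Real.log (P / mmse) ≤ 2 * R := by
    rwa [Real.log_le_iff_le_exp (by positivity), div_le_iff₀ hmmse, ← div_le_iff₀' (by positivity),
      div_eq_mul_inv, ← Real.exp_neg]
  linarith

lemma exists_lt_neg_log_one_sub (hP : 0 < P) (hR : 0 < R) (hmmse : 0 ≤ mmse)
    (hlt : mmse < P * Real.exp (-(2 * R))) :
    ∃ b ∈ Set.Ioo (0 : ℝ) 1, b * P < P - mmse ∧ R < -(Real.log (1 - b) / 2) := by
  have hP' : (0 : ℝ) < P := hP
  obtain ⟨v, hmmse_lt, hv⟩ := exists_between hlt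
  have hv0 : 0 < v / P := div_pos (hmmse.trans_lt hmmse_lt) hP'
  have hvexp : v / P < Real.exp (-(2 * R)) := (div_lt_iff₀' hP').2 hv
  have hexp : Real.exp (-(2 * R)) < 1 := Real.exp_lt_one_iff.2 (by linarith)
  have hlog := (Real.log_lt_iff_lt_exp hv0).2 hvexp
  refine ⟨1 - v / P, ⟨by linarith, by linarith⟩, ?_, ?_⟩
  · rw [sub_mul, div_mul_cancel₀ _ hP'.ne', one_mul]
    linarith
  · rw [sub_sub_cancel]
    linarith

variable [MeasurableSpace 𝒴] {W : ∀ n, Kernel (Fin n → ℝ) (Fin n → 𝒴)}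
  {μ : Measure (ℕ → ℝ × 𝒴)}

lemma normalizedMMSE_nonneg (P : ℝ≥0) (W : ∀ n, Kernel (Fin n → ℝ) (Fin n → 𝒴)) (S : ℕ) :
    0 ≤ normalizedMMSE P W S :=
  mul_nonneg (by positivity) (integral_nonneg fun _ => Finset.sum_nonneg fun _ _ => sq_nonneg _)

/-- A bound on the error probability of the decoder with smoother `g` and scaling `a`: the first
term bounds the probability that the decoding metric of the transmitted codeword or the energy of
its estimate deviates from its mean by more than `η` per symbol, the second one is a union bound
over the other codewords. -/
noncomputable def errorBound (μ : Measure (ℕ → ℝ × 𝒴)) (g : (Fin S → 𝒴) → Fin S → ℝ)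
    (a η γ : ℝ) (N : ℕ) : ℝ :=
  (birkhoffDeviation μ shift^[S] (loss g a) N + birkhoffDeviation μ shift^[S] (loss g 0) N) /
    (S * η) + 2 * Real.exp (-(N * S * γ))

lemma tendsto_exp_neg_mul_atTop_nhds_zero (hS : S ≠ 0) (hγ : 0 < γ) :
    Tendsto (fun N : ℕ => Real.exp (-(N * S * γ))) atTop (𝓝 0) :=
  Real.tendsto_exp_neg_atTop_nhds_zero.comp ((tendsto_natCast_atTop_atTop.atTop_mul_const
    (Nat.cast_pos.2 (Nat.pos_of_ne_zero hS))).atTop_mul_const hγ)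

variable [∀ n, IsMarkovKernel (W n)]

namespace IsStationaryErgodic

section SuperSymbol

variable {g : (Fin S → 𝒴) → Fin S → ℝ}

lemma pairwiseExponent_segment_le (hμ : IsStationaryErgodic P W μ) (hg : IsMMSESmoother P W S g)
    (hP : 0 < P) (hb : b ∈ Set.Ioo 0 1) (hba : b ≤ scaling P W S g) (hη : 0 ≤ η) {N : ℕ}
    {ω : ℕ → ℝ × 𝒴}
    (hmetric : ‖birkhoffAverage ℝ shift^[S] (loss g (scaling P W S g)) N ω -
      ∫ ω', loss g (scaling P W S g) ω' ∂μ‖ ≤ S * η)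
    (henergy : ‖birkhoffAverage ℝ shift^[S] (loss g 0) N ω - ∫ ω', loss g 0 ω' ∂μ‖ ≤ S * η) :
    pairwiseExponent P g (scaling P W S g) (chernoffParameter P (scaling P W S g) b)
        (segment (N * S) ω) ≤
      N * S * (Real.log (1 - b) / 2 + η / (b * P * (1 - b))) := by
  have hpower : meanPower μ g = scaling P W S g * P := by
    rw [hμ.scaling_eq hg, div_mul_cancel₀ _ (NNReal.coe_ne_zero.2 hP.ne')]
  rw [hμ.integral_loss hg, hpower, Real.norm_eq_abs, abs_le] at hmetric henergy
  rw [pairwiseExponent, metric_segment_eq_mul_birkhoffAverage,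
    metric_segment_eq_mul_birkhoffAverage, Nat.cast_mul]
  refine chernoff_exponent_le hP hb hba hη (by positivity) ?_ ?_ <;>
    rw [mul_assoc] <;> gcongr <;> linarith

lemma jointLaw_lt_pairwiseExponent_le (hμ : IsStationaryErgodic P W μ)
    (hg : IsMMSESmoother P W S g) (hP : 0 < P) (hS : S ≠ 0) (hb : b ∈ Set.Ioo 0 1)
    (hba : b ≤ scaling P W S g) (hη : 0 < η) (N : ℕ) :
    jointLaw P W (N * S) {p | N * S * (Real.log (1 - b) / 2 + η / (b * P * (1 - b))) <
        pairwiseExponent P g (scaling P W S g) (chernoffParameter P (scaling P W S g) b) p} ≤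
      ENNReal.ofReal ((birkhoffDeviation μ shift^[S] (loss g (scaling P W S g)) N +
        birkhoffDeviation μ shift^[S] (loss g 0) N) / (S * η)) := by
  have := hμ.isProbabilityMeasure
  have hSη : 0 < S * η := mul_pos (Nat.cast_pos.2 (Nat.pos_of_ne_zero hS)) hη
  have hdeviation : ∀ a, μ {ω | S * η ≤ ‖birkhoffAverage ℝ shift^[S] (loss g a) N ω -
      ∫ ω', loss g a ω' ∂μ‖} ≤
        ENNReal.ofReal (birkhoffDeviation μ shift^[S] (loss g a) N / (S * η)) := fun a =>
    measure_le_norm_birkhoffAverage_sub_le (hμ.ergodic.toMeasurePreserving.iterate S)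
      (hμ.integrable_loss hg a) N hSη
  rw [← (hμ.measurePreserving_segment (N * S)).measure_preimage (measurableSet_lt measurable_const
    (measurable_pairwiseExponent P hg.measurable _ _)).nullMeasurableSet, add_div,
    ENNReal.ofReal_add (div_nonneg (birkhoffDeviation_nonneg _ _) hSη.le)
      (div_nonneg (birkhoffDeviation_nonneg _ _) hSη.le)]
  refine (measure_mono fun ω hω => ?_).trans ((measure_union_le _ _).trans
    (add_le_add (hdeviation _) (hdeviation 0)))
  by_contra htypical
  simp only [Set.mem_union, Set.mem_ofPred_eq, not_or, not_le] at htypical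
  exact (hμ.pairwiseExponent_segment_le hg hP hb hba hη.le htypical.1.le htypical.2.le).not_gt hω

lemma averageError_le_errorBound (hμ : IsStationaryErgodic P W μ) (hg : IsMMSESmoother P W S g)
    (hP : 0 < P) (hS : S ≠ 0) (hb : b ∈ Set.Ioo 0 1) (hba : b ≤ scaling P W S g) (hη : 0 < η)
    (hR : 0 ≤ R) (hmargin : R + γ + η / (b * P * (1 - b)) ≤ -(Real.log (1 - b) / 2)) (N : ℕ) :
    averageError P W S g (scaling P W S g) R N ≤
      ENNReal.ofReal (errorBound μ g (scaling P W S g) η γ N) := by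
  have hexponent : (N * S : ℝ) * (Real.log (1 - b) / 2 + η / (b * P * (1 - b))) ≤
      -(N * S * (R + γ)) := by
    rw [← mul_neg]
    gcongr
    linarith
  rw [errorBound, ENNReal.ofReal_add (div_nonneg (add_nonneg (birkhoffDeviation_nonneg _ _)
    (birkhoffDeviation_nonneg _ _)) (by positivity)) (by positivity)]
  calc averageError P W S g (scaling P W S g) R N
      ≤ jointLaw P W (N * S) {p | -(N * S * (R + γ)) < pairwiseExponent P g (scaling P W S g)
          (chernoffParameter P (scaling P W S g) b) p} +
        numMessages N S R * ENNReal.ofReal (Real.exp (-(N * S * (R + γ)))) :=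
        averageError_le P W hg.measurable _ R _ (chernoffParameter_nonneg hb)
    _ ≤ _ := by
        gcongr ?_ + ?_
        · exact (measure_mono fun p hp => hexponent.trans_lt hp).trans
            (hμ.jointLaw_lt_pairwiseExponent_le hg hP hS hb hba hη N)
        · exact numMessages_mul_exp_le hR γ

end SuperSymbol

variable {g : ∀ S, (Fin S → 𝒴) → Fin S → ℝ}

lemma tendsto_meanPower (hμ : IsStationaryErgodic P W μ) (hg : ∀ S, IsMMSESmoother P W S (g S))
    (hmmse : Tendsto (normalizedMMSE P W) atTop (𝓝 mmse)) :
    Tendsto (fun S => meanPower μ (g S)) atTop (𝓝 (P - mmse)) := by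
  refine (hmmse.const_sub (P : ℝ)).congr' ?_
  filter_upwards [eventually_ne_atTop 0] with S hS
  rw [hμ.normalizedMMSE_eq (hg S) hS, sub_sub_cancel]

theorem exists_eventually_averageError_le_errorBound (hμ : IsStationaryErgodic P W μ)
    (hg : ∀ S, IsMMSESmoother P W S (g S)) (hP : 0 < P)
    (hmmse : Tendsto (normalizedMMSE P W) atTop (𝓝 mmse)) (hR : (R : EReal) < gmiRate P mmse) :
    ∃ η γ : ℝ, 0 < η ∧ 0 < γ ∧ ∀ᶠ S : ℕ in atTop, ∀ N : ℕ,
      averageError P W S (g S) (scaling P W S (g S)) R N ≤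
        ENNReal.ofReal (errorBound μ (g S) (scaling P W S (g S)) η γ N) := by
  rcases le_or_gt R 0 with hR0 | hR0
  · refine ⟨1, 1, one_pos, one_pos, .of_forall fun S N => ?_⟩
    rw [averageError_eq_zero_of_nonpos P W (g S) _ hR0]
    exact zero_le
  have hP' : (0 : ℝ) < P := hP
  obtain ⟨b, hb, hbP, hRb⟩ := exists_lt_neg_log_one_sub hP hR0
    (ge_of_tendsto' hmmse (normalizedMMSE_nonneg P W)) (lt_of_lt_gmiRate hP hR)
  obtain ⟨γ, hγ, hmargin⟩ : ∃ γ > 0, R + γ + γ = -(Real.log (1 - b) / 2) :=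
    ⟨(-(Real.log (1 - b) / 2) - R) / 2, by linarith, by ring⟩
  have hbound : 0 < b * P * (1 - b) := mul_pos (mul_pos hb.1 hP') (sub_pos.2 hb.2)
  refine ⟨γ * (b * P * (1 - b)), γ, mul_pos hγ hbound, hγ, ?_⟩
  filter_upwards [(hμ.tendsto_meanPower hg hmmse).eventually_const_lt hbP,
    eventually_ne_atTop 0] with S hS hS0 N
  have hba : b ≤ scaling P W S (g S) := by
    rw [hμ.scaling_eq (hg S), le_div_iff₀ hP']
    exact hS.le
  refine hμ.averageError_le_errorBound (hg S) hP hS0 hb hba (mul_pos hγ hbound) hR0.le ?_ N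
  rw [mul_div_cancel_right₀ _ hbound.ne', hmargin]

theorem isAchievable_gmiRate (hμ : IsStationaryErgodic P W μ)
    (hg : ∀ S, IsMMSESmoother P W S (g S)) (hP : 0 < P)
    (hmmse : Tendsto (normalizedMMSE P W) atTop (𝓝 mmse)) :
    IsAchievable P W g (fun S => scaling P W S (g S)) (gmiRate P mmse) := by
  intro R hR ε hε
  obtain ⟨η, γ, hη, hγ, hbound⟩ :=
    hμ.exists_eventually_averageError_le_errorBound hg hP hmmse hR
  obtain ⟨δ, hδ, hδε⟩ := ENNReal.lt_iff_exists_nnreal_btwn.1 hε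
  have hδ' : (0 : ℝ) < δ := NNReal.coe_pos.2 (ENNReal.coe_pos.1 hδ)
  filter_upwards [hbound, hμ.eventually_birkhoffDeviation_loss_le hg
    (hμ.tendsto_meanPower hg hmmse) (show 0 < η * δ / 4 by positivity), eventually_gt_atTop 0]
    with S herror hdeviation hS
  have hexp := ((tendsto_exp_neg_mul_atTop_nhds_zero hS.ne' hγ).const_mul 2).eventually_le_const
    (show 2 * 0 < (δ : ℝ) / 2 by rw [mul_zero]; positivity)
  filter_upwards [hdeviation _ (hμ.scaling_mem_Icc (hg S)), hdeviation 0 ⟨le_rfl, zero_le_one⟩,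
    hexp] with N hmetric henergy hN
  refine (herror N).trans (le_trans ?_ hδε.le)
  refine ENNReal.ofReal_le_of_le_toReal ?_
  calc errorBound μ (g S) (scaling P W S (g S)) η γ N
      ≤ (S * (η * δ / 4) + S * (η * δ / 4)) / (S * η) + δ / 2 := by
        unfold errorBound
        gcongr
    _ = δ := by
        field_simp
        ring

theorem isAchievableFixedLength_gmiRate (hμ : IsStationaryErgodic P W μ)
    (hg : ∀ S, IsMMSESmoother P W S (g S)) (hP : 0 < P)
    (hmmse : Tendsto (normalizedMMSE P W) atTop (𝓝 mmse)) :
    IsAchievableFixedLength P W g (fun S => scaling P W S (g S))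
      (fun S => Ergodic shift^[S] μ) (gmiRate P mmse) := by
  have := hμ.isProbabilityMeasure
  intro R hR
  obtain ⟨η, γ, -, hγ, hbound⟩ := hμ.exists_eventually_averageError_le_errorBound hg hP hmmse hR
  filter_upwards [hbound, eventually_ne_atTop 0] with S herror hS hergodic
  have hdeviation : ∀ a, Tendsto (birkhoffDeviation μ shift^[S] (loss (g S) a)) atTop (𝓝 0) :=
    fun a => tendsto_birkhoffDeviation hergodic (hμ.memLp_loss (hg S) a)
  have herrorBound :
      Tendsto (errorBound μ (g S) (scaling P W S (g S)) η γ) atTop (𝓝 0) := by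
    have hsum := (((hdeviation (scaling P W S (g S))).add (hdeviation 0)).div_const (S * η)).add
      ((tendsto_exp_neg_mul_atTop_nhds_zero hS hγ).const_mul 2)
    rwa [add_zero, zero_div, mul_zero, add_zero] at hsum
  refine tendsto_of_tendsto_of_tendsto_of_le_of_le tendsto_const_nhds ?_ (fun _ => zero_le) herror
  simpa only [ENNReal.ofReal_zero] using ENNReal.tendsto_ofReal herrorBound

end IsStationaryErgodic

end Achievability

end MemoryChannel

theorem mainTheorem6 {𝒴 : Type*} [MeasurableSpace 𝒴] (P : ℝ≥0) (hP : 0 < P)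
    (W : ∀ n, Kernel (Fin n → ℝ) (Fin n → 𝒴)) [∀ n, IsMarkovKernel (W n)]
    (μ : Measure (ℕ → ℝ × 𝒴)) (hμ : MemoryChannel.IsStationaryErgodic P W μ)
    (g : ∀ S, (Fin S → 𝒴) → (Fin S → ℝ))
    (hg : ∀ S, MemoryChannel.IsMMSESmoother P W S (g S))
    (mmse : ℝ) (hmmse : Tendsto (MemoryChannel.normalizedMMSE P W) atTop (𝓝 mmse)) :
    MemoryChannel.IsAchievable P W g (fun S => MemoryChannel.scaling P W S (g S))
        (MemoryChannel.gmiRate P mmse) ∧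
      MemoryChannel.IsAchievableFixedLength P W g (fun S => MemoryChannel.scaling P W S (g S))
        (fun S => Ergodic (MemoryChannel.shift^[S]) μ) (MemoryChannel.gmiRate P mmse) := by
  exact ⟨hμ.isAchievable_gmiRate hg hP hmmse, hμ.isAchievableFixedLength_gmiRate hg hP hmmse⟩
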